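/- Conventions. Let $X$ be a Banach space. An $X$-valued random variable is a Borel measurable map with separable range. For a filtration $(\mathcal F_n)_{n\ge1}$ on a complete probability space $(\Omega,\mathcal A,\mathbb P)$ put $\mathcal F_0=\{\Omega,\varnothing\}$ and $\mathcal F_\infty=\sigma(\mathcal F_n:n\ge1)$. The difference sequence of $(f_n)_{n\ge1}$ is $d_n=f_n-f_{n-1}$, $n\ge 1$, with $f_0\equiv0$, and $f_n^*=\max_{1\le j\le n}\|f_j\|$. For an adapted sequence $f$, a sequence $g=(g_n)_{n\ge1}$ of $X$-valued random variables on $(\Omega,\mathcal A,\mathbb P)$ with difference sequence $(e_n)_{n\ge1}$ is a *decoupled sum sequence* of $f$ if for all $n\ge1$ and all Borel sets $B,B_1,\dots,B_n\subseteq X$, almost surely, $$\mathbb P(d_n\in B\mid\mathcal F_{n-1})=\mathbb P(e_n\in B\mid\mathcal F_\infty),\qquad \mathbb P(e_1\in B_1,\dots,e_n\in B_n\mid\mathcal F_\infty)=\prod_{k=1}^n\mathbb P(e_k\in B_k\mid\mathcal F_\infty).$$ For $p\in(0,\infty)$, the *decoupling inequality holds in $X$ for $p$* if there is a constant $D$ such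 that $\|f_n\|_{L^p(\Omega;X)}\le D\,\|g_n\|_{L^p(\Omega;X)}$ for all $n\ge1$, all complete probability spaces with a filtration, all adapted sequences $f$ in $L^p(\Omega;X)$ and all decoupled sum sequences $g$ of $f$; the least such $D\geq 0$ is $D_p(X)$. A random variable $\xi$ is *$\mathcal G$-conditionally symmetric* if $\mathbb P(\xi\in B\mid\mathcal G)=\mathbb P(-\xi\in B\mid\mathcal G)$ almost surely for all Borel sets $B$. **Corollary.** Let $X$ be a Banach space in which the decoupling inequality holds for some $p\in(0,\infty)$, and let $q\in(0,\infty)$. There is a constant $C=C_{X,p,q}<\infty$, depending only on $X,p,q$, such that for every non-decreasing continuous $\Phi:[0,\infty)\to[0,\infty)$ with $\Phi(0)=0$ and $\Phi(st)\le s^q\Phi(t)$ for all $s\ge1$, $t\ge0$, every complete probability space with a filtration $(\mathcal F_n)_{n\ge1}$, every adapted $X$-valued sequence $f=(f_n)_{n\ge1}$ such that $d_n$ is $\mathcal F_{n-1}$-conditionally symmetric for all $n\ge1$, and every decoupled sum sequence $g$ of $f$, $$\mathbb E\,\Phi(f_n^*)\le C\,\mathbb E\,\Phi(\|g_n\|),\qquad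 n\ge1,$$ where both sides may be infinite. Moreover, if $p\ge1$, one can take $$C=2^{2q+2}\Big[2^{p+q+1}(2^q+1)\big(e\,2^{2+\frac1p}D_p(X)+1\big)^q\big(\tfrac qp\big)^q+1\Big].$$ -/

import Mathlib

open MeasureTheory ProbabilityTheory
open scoped NNReal ENNReal

universe u v

noncomputable section

namespace Decoupling

/-- The difference sequence `d n = f n - f (n - 1)`. Sequences `(f_n)_{n ≥ 1}` are written as
functions on `ℕ` with `f 0 = 0`, so only the values at `n ≥ 1` matter (at `n = 0` it is `0`). -/
def diffSeq {Ω : Type u} {X : Type v} [NormedAddCommGroup X] (f : ℕ → Ω → X) (n : ℕ) : Ω → X :=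
  fun ω => f n ω - f (n - 1) ω

/-- `ξ` is `m`-conditionally symmetric:
`P(ξ ∈ B | m) = P(-ξ ∈ B | m)` almost surely, for every Borel set `B`. -/
def CondSymmetric {Ω : Type u} {X : Type v} [MeasurableSpace Ω] [NormedAddCommGroup X]
    [MeasurableSpace X] (μ : Measure Ω) (m : MeasurableSpace Ω) (ξ : Ω → X) : Prop :=
  ∀ B : Set X, MeasurableSet B →
    μ⟦ξ ⁻¹' B | m⟧ =ᵐ[μ] μ⟦(fun ω => -ξ ω) ⁻¹' B | m⟧

/-- `(e n)_{n ≥ 1}` is an `𝓕_∞`-decoupled tangent sequence of `(d n)_{n ≥ 1}`, where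
`𝓕_∞ = ⨆ n, 𝓕 n`. A random variable is a strongly measurable function, i.e. a Borel
measurable function with separable range. -/
structure IsDecoupledTangent {Ω : Type u} {X : Type v} [mΩ : MeasurableSpace Ω]
    [NormedAddCommGroup X] [MeasurableSpace X] (μ : Measure Ω) (𝓕 : Filtration ℕ mΩ)
    (d e : ℕ → Ω → X) : Prop where
  stronglyMeasurable : ∀ n, 1 ≤ n → StronglyMeasurable (e n)
  tangent : ∀ n, 1 ≤ n → ∀ B : Set X, MeasurableSet B →
    μ⟦d n ⁻¹' B | 𝓕 (n - 1)⟧ =ᵐ[μ] μ⟦e n ⁻¹' B | ⨆ k, 𝓕 k⟧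
  condIndep : ∀ n, 1 ≤ n → ∀ B : ℕ → Set X, (∀ k, MeasurableSet (B k)) →
    μ⟦⋂ k ∈ Finset.Icc 1 n, e k ⁻¹' B k | ⨆ k, 𝓕 k⟧
      =ᵐ[μ] fun ω => ∏ k ∈ Finset.Icc 1 n, (μ⟦e k ⁻¹' B k | ⨆ k, 𝓕 k⟧) ω

/-- `g` is an `𝓕_∞`-decoupled sum sequence of `f`. -/
def IsDecoupledSum {Ω : Type u} {X : Type v} [mΩ : MeasurableSpace Ω]
    [NormedAddCommGroup X] [MeasurableSpace X] (μ : Measure Ω) (𝓕 : Filtration ℕ mΩ)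
    (f g : ℕ → Ω → X) : Prop :=
  g 0 = 0 ∧ IsDecoupledTangent μ 𝓕 (diffSeq f) (diffSeq g)

/-- `‖f n‖_p ≤ D ‖g n‖_p` for all complete probability spaces, all filtrations (`𝓕 0` trivial),
all adapted `L^p`-sequences `f`, and all decoupled sum sequences `g` of `f`. -/
def DecouplingWith (X : Type v) [NormedAddCommGroup X] [MeasurableSpace X]
    (p : ℝ) (D : ℝ≥0) : Prop :=
  ∀ (Ω : Type u) [mΩ : MeasurableSpace Ω] (μ : Measure Ω) [IsProbabilityMeasure μ]
    [μ.IsComplete] (𝓕 : Filtration ℕ mΩ) (f g : ℕ → Ω → X),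
    𝓕 0 = ⊥ → f 0 = 0 → StronglyAdapted 𝓕 f → (∀ n, MemLp (f n) (ENNReal.ofReal p) μ) →
    IsDecoupledSum μ 𝓕 f g →
    ∀ n, 1 ≤ n → eLpNorm (f n) (ENNReal.ofReal p) μ ≤ D * eLpNorm (g n) (ENNReal.ofReal p) μ

/-- The decoupling inequality holds in `X` for `p`. -/
def DecouplingInequality (X : Type v) [NormedAddCommGroup X] [MeasurableSpace X] (p : ℝ) : Prop :=
  ∃ D : ℝ≥0, DecouplingWith.{u, v} X p D

/-- The least decoupling constant `D_p(X)`. -/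
def decouplingConst (X : Type v) [NormedAddCommGroup X] [MeasurableSpace X] (p : ℝ) : ℝ≥0 :=
  sInf {D : ℝ≥0 | DecouplingWith.{u, v} X p D}

/-- The maximal function `f_n^* = sup_{1 ≤ j ≤ n} ‖f_j‖`. -/
def maxFun {Ω : Type u} {X : Type v} [NormedAddCommGroup X] (f : ℕ → Ω → X) (n : ℕ) (ω : Ω) :
    ℝ≥0 :=
  (Finset.Icc 1 n).sup fun j => ‖f j ω‖₊

/-- Non-decreasing continuous `Φ : ℝ₊ → ℝ₊` with `Φ 0 = 0` and `Φ (s t) ≤ s ^ q Φ t` for `s ≥ 1`.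
(Demanding the last inequality for `s < 1` too would leave only the multiples of `t ^ q`.) -/
structure GrowthClass (q : ℝ) (Φ : ℝ≥0 → ℝ≥0) : Prop where
  mono : Monotone Φ
  cont : Continuous Φ
  zero : Φ 0 = 0
  growth : ∀ s t : ℝ≥0, 1 ≤ s → Φ (s * t) ≤ s ^ q * Φ t

/-- The constant
`2^{2q+2} [ 2^{p+q+1} (2^q + 1) (e 2^{2+1/p} D + 1)^q (q/p)^q + 1 ]`. -/
def maximalConst (p q D : ℝ) : ℝ :=
  2 ^ (2 * q + 2) *
    (2 ^ (p + q + 1) * (2 ^ q + 1) * (Real.exp 1 * 2 ^ (2 + 1 / p) * D + 1) ^ q * (q / p) ^ q + 1)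

end Decoupling

end

namespace Decoupling

section FirstPassage

/-- The part of `E j` that lies in no earlier `E i`. -/
def firstHit {α : Type*} (E : ℕ → Set α) (j : ℕ) : Set α := {x | x ∈ E j ∧ ∀ i < j, x ∉ E i}

variable {α : Type*} {E : ℕ → Set α}

lemma exists_mem_firstHit {m : ℕ} {x : α} (h : ∃ j ≤ m, x ∈ E j) : ∃ j ≤ m, x ∈ firstHit E j := by
  classical
  have h' : ∃ j, x ∈ E j := by obtain ⟨j, -, hj⟩ := h; exact ⟨j, hj⟩
  obtain ⟨j, hjm, hj⟩ := h
  exact ⟨Nat.find h', (Nat.find_min' h' hj).trans hjm, Nat.find_spec h',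
    fun i hi => Nat.find_min h' hi⟩

lemma pairwise_disjoint_firstHit : Pairwise (Function.onFun Disjoint (firstHit E)) := by
  intro i j hij
  rw [Function.onFun, Set.disjoint_left]
  intro x hi hj
  rcases lt_or_gt_of_ne hij with h | h
  · exact hj.2 i h hi.1
  · exact hi.2 j h hj.1

variable [MeasurableSpace α]

lemma measurableSet_firstHit (hE : ∀ j, MeasurableSet (E j)) (j : ℕ) :
    MeasurableSet (firstHit E j) := by
  have : firstHit E j = E j ∩ ⋂ i ∈ Finset.range j, (E i)ᶜ := by
    ext x; simp [firstHit]
  rw [this]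
  exact (hE j).inter (Finset.measurableSet_biInter _ fun i _ => (hE i).compl)

variable {Q : Measure α} {m : ℕ}

lemma sum_measure_firstHit_inter_le (hE : ∀ j, MeasurableSet (E j)) {G : Set α}
    (hG : MeasurableSet G) :
    ∑ j ∈ Finset.range (m + 1), Q (firstHit E j ∩ G) ≤ Q G := by
  rw [← measure_biUnion_finset]
  · exact measure_mono (Set.iUnion₂_subset fun j _ => Set.inter_subset_right)
  · intro i _ j _ hij
    exact (pairwise_disjoint_firstHit hij).mono Set.inter_subset_left Set.inter_subset_left
  · exact fun j _ => (measurableSet_firstHit hE j).inter hG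

lemma measure_le_sum_firstHit {F : Set α} (hF : ∀ x ∈ F, ∃ j ≤ m, x ∈ E j) :
    Q F ≤ ∑ j ∈ Finset.range (m + 1), Q (firstHit E j ∩ F) := by
  refine (measure_mono ?_).trans (measure_biUnion_finset_le _ _)
  intro x hx
  obtain ⟨j, hj, hxj⟩ := exists_mem_firstHit (hF x hx)
  exact Set.mem_biUnion (by simpa [Nat.lt_succ_iff] using hj) ⟨hxj, hx⟩

/-- A reflection-type estimate: bounding each first-hit part bounds the union. -/
lemma measure_exists_le_of_firstHit (hE : ∀ j, MeasurableSet (E j)) {G : Set α}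
    (hG : MeasurableSet G) {c : ℝ≥0∞}
    (h : ∀ j ≤ m, Q (firstHit E j) ≤ c * Q (firstHit E j ∩ G)) :
    Q {x | ∃ j ≤ m, x ∈ E j} ≤ c * Q G := by
  refine (measure_le_sum_firstHit (E := E) (m := m) fun x hx => hx).trans ?_
  refine le_trans (Finset.sum_le_sum fun j hj => ?_)
    ((Finset.mul_sum _ _ _).symm.le.trans (mul_le_mul_right
      (sum_measure_firstHit_inter_le (m := m) hE hG) c))
  exact (measure_mono Set.inter_subset_left).trans
    (h j (by simpa [Nat.lt_succ_iff] using hj))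

lemma measure_le_mul_of_firstHit (hE : ∀ j, MeasurableSet (E j)) {F : Set α}
    (hF : ∀ x ∈ F, ∃ j ≤ m, x ∈ E j) {c : ℝ≥0∞}
    (h : ∀ j ≤ m, Q (firstHit E j ∩ F) ≤ c * Q (firstHit E j)) :
    Q F ≤ c * Q {x | ∃ j ≤ m, x ∈ E j} := by
  have hU : MeasurableSet {x | ∃ j ≤ m, x ∈ E j} := by
    have : {x | ∃ j ≤ m, x ∈ E j} = ⋃ j ∈ Finset.range (m + 1), E j := by
      ext x; simp
    rw [this]
    exact Finset.measurableSet_biUnion _ fun j _ => hE j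
  refine (measure_le_sum_firstHit hF).trans ?_
  refine le_trans (Finset.sum_le_sum fun j hj => ?_)
    ((Finset.mul_sum _ _ _).symm.le.trans (mul_le_mul_right
      (sum_measure_firstHit_inter_le (m := m) hE hU) c))
  have hj' : j ≤ m := by simpa [Nat.lt_succ_iff] using hj
  refine (h j hj').trans (mul_le_mul_right (measure_mono ?_) c)
  exact fun x hx => ⟨hx, j, hj', hx.1⟩

end FirstPassage

section SymmetricProduct

variable {X : Type v} [NormedAddCommGroup X] [MeasurableSpace X] [BorelSpace X]

omit [NormedAddCommGroup X] [BorelSpace X] in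
lemma measurePreserving_infinitePi {ν : ℕ → Measure X} [∀ i, IsProbabilityMeasure (ν i)]
    {ψ : ℕ → X → X} (hψ : ∀ i, MeasurePreserving (ψ i) (ν i) (ν i)) :
    MeasurePreserving (fun (x : ℕ → X) i => ψ i (x i)) (Measure.infinitePi ν)
      (Measure.infinitePi ν) := by
  refine ⟨measurable_pi_lambda _ fun i => (hψ i).measurable.comp (measurable_pi_apply i), ?_⟩
  rw [Measure.infinitePi_map_pi ν fun i => (hψ i).measurable]
  congr 1
  ext1 i
  exact (hψ i).map_eq

/-- Reflecting a symmetric measure outside a symmetric set preserves it. -/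
lemma measurePreserving_reflect {ν : Measure X} (hν : MeasurePreserving (fun x : X => -x) ν ν)
    {A : Set X} [DecidablePred (· ∈ A)] (hA : MeasurableSet A) (hneg : ∀ x, -x ∈ A ↔ x ∈ A) :
    MeasurePreserving (fun x => if x ∈ A then x else -x) ν ν := by
  have hm : Measurable (fun x : X => if x ∈ A then x else -x) :=
    Measurable.ite hA measurable_id measurable_neg
  refine ⟨hm, ?_⟩
  ext B hB
  rw [Measure.map_apply hm hB, ← measure_inter_add_sdiff _ hA, ← measure_inter_add_sdiff B hA]
  congr 1
  · congr 1
    ext x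
    simp only [Set.mem_inter_iff, Set.mem_preimage]
    constructor <;> rintro ⟨h, h'⟩ <;> simpa [h'] using h
  · rw [← hν.measure_preimage (hB.diff hA).nullMeasurableSet]
    congr 1
    ext x
    simp only [Set.mem_sdiff, Set.mem_preimage, hneg]
    constructor <;> rintro ⟨h, h'⟩ <;> simpa [h'] using h

omit [BorelSpace X] in
lemma measurePreserving_flip {ν : ℕ → Measure X} [∀ i, IsProbabilityMeasure (ν i)]
    (hν : ∀ i, MeasurePreserving (fun x : X => -x) (ν i) (ν i)) (s : ℕ → Prop) [DecidablePred s] :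
    MeasurePreserving (fun (x : ℕ → X) i => if s i then x i else -x i) (Measure.infinitePi ν)
      (Measure.infinitePi ν) := by
  have := measurePreserving_infinitePi (ν := ν) (ψ := fun i x => if s i then x else -x) fun i => by
    by_cases h : s i
    · simp only [h, if_true]
      exact MeasurePreserving.id (ν i)
    · simpa [h] using hν i
  exact this

variable [NormedSpace ℝ X]

omit [MeasurableSpace X] [BorelSpace X] in
lemma lt_norm_or_lt_norm_of_add_eq {y z w : X} {t : ℝ} (h : y + z = w + w) (ht : t < ‖w‖) :
    t < ‖y‖ ∨ t < ‖z‖ := by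
  by_contra! hc
  have h1 : ‖w + w‖ = 2 * ‖w‖ := by rw [← two_smul ℝ w, norm_smul]; simp
  have h2 := norm_add_le y z
  rw [h, h1] at h2
  linarith [hc.1, hc.2]

variable [SecondCountableTopology X]
variable {ν : ℕ → Measure X} [∀ i, IsProbabilityMeasure (ν i)]
  (hν : ∀ i, MeasurePreserving (fun x : X => -x) (ν i) (ν i))
  {φ : X → X} (hφ : Measurable φ) (hodd : ∀ x, φ (-x) = -φ x)

/-- The event that one of the first `m` partial sums of `φ (x 0), φ (x 1), …` exceeds `t`. -/
def exceed (φ : X → X) (m : ℕ) (t : ℝ) : Set (ℕ → X) :=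
  {x | ∃ j ≤ m, t < ‖∑ i ∈ Finset.range j, φ (x i)‖}

omit [NormedSpace ℝ X] in
include hφ in
lemma measurableSet_lt_norm_sum (s : Finset ℕ) (t : ℝ) :
    MeasurableSet {x : ℕ → X | t < ‖∑ i ∈ s, φ (x i)‖} :=
  measurableSet_lt measurable_const (by fun_prop)

omit [NormedSpace ℝ X] in
include hφ in
lemma measurableSet_exceed (m : ℕ) (t : ℝ) : MeasurableSet (exceed φ m t) := by
  have : exceed φ m t = ⋃ j ∈ Finset.range (m + 1),
      {x : ℕ → X | t < ‖∑ i ∈ Finset.range j, φ (x i)‖} := by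
    ext x; simp [exceed]
  rw [this]
  exact Finset.measurableSet_biUnion _ fun j _ => measurableSet_lt_norm_sum hφ _ _

omit [NormedSpace ℝ X] [SecondCountableTopology X] [BorelSpace X] in
include hν in
/-- If the first-hit event is invariant under a coordinatewise sign change `s`, and on it `G` or
its sign-changed version occurs, then it is controlled by `G`. -/
lemma measure_le_two_mul_of_flip (s : ℕ → Prop) [DecidablePred s] {T G : Set (ℕ → X)}
    (hT : MeasurableSet T) (hG : MeasurableSet G)
    (hTs : ∀ x, (fun i => if s i then x i else -x i) ∈ T ↔ x ∈ T)
    (h : ∀ x ∈ T, x ∈ G ∨ (fun i => if s i then x i else -x i) ∈ G) :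
    Measure.infinitePi ν T ≤ 2 * Measure.infinitePi ν (T ∩ G) := by
  have hp := measurePreserving_flip hν s
  calc Measure.infinitePi ν T
      ≤ Measure.infinitePi ν ((T ∩ G) ∪
          (fun (x : ℕ → X) i => if s i then x i else -x i) ⁻¹' (T ∩ G)) := by
        refine measure_mono fun x hx => ?_
        rcases h x hx with h | h
        · exact Or.inl ⟨hx, h⟩
        · exact Or.inr ⟨(hTs x).2 hx, h⟩
    _ ≤ _ := (measure_union_le _ _).trans_eq (by
        rw [hp.measure_preimage (hT.inter hG).nullMeasurableSet, two_mul])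

include hν hφ hodd in
/-- Lévy's maximal inequality. -/
lemma levy_sum (n : ℕ) (t : ℝ) :
    Measure.infinitePi ν (exceed φ n t) ≤
      2 * Measure.infinitePi ν {x | t < ‖∑ i ∈ Finset.range n, φ (x i)‖} := by
  have hE : ∀ j, MeasurableSet {x : ℕ → X | t < ‖∑ i ∈ Finset.range j, φ (x i)‖} :=
    fun j => measurableSet_lt_norm_sum hφ _ _
  refine measure_exists_le_of_firstHit (E := fun j => {x | t < ‖∑ i ∈ Finset.range j, φ (x i)‖})
    hE (hE n) fun j hj => ?_
  have key : ∀ (x : ℕ → X), ∀ l ≤ j, ∑ i ∈ Finset.range l, φ (if i < j then x i else -x i) =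
      ∑ i ∈ Finset.range l, φ (x i) := fun x l hl =>
    Finset.sum_congr rfl fun i hi => by
      rw [if_pos ((Finset.mem_range.1 hi).trans_le hl)]
  refine measure_le_two_mul_of_flip hν (fun i => i < j) (measurableSet_firstHit hE j) (hE n)
    (fun x => ?_) fun x hx => ?_
  · simp only [firstHit, Set.mem_ofPred_eq, key x j le_rfl]
    refine and_congr_right fun _ => forall₂_congr fun i hi => ?_
    rw [key x i hi.le]
  · refine lt_norm_or_lt_norm_of_add_eq (w := ∑ i ∈ Finset.range j, φ (x i)) ?_ hx.1
    rw [← Finset.sum_range_add_sum_Ico _ hj, ← Finset.sum_range_add_sum_Ico _ hj, key x j le_rfl]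
    have : ∑ i ∈ Finset.Ico j n, φ (if i < j then x i else -x i) =
        -∑ i ∈ Finset.Ico j n, φ (x i) := by
      rw [← Finset.sum_neg_distrib]
      refine Finset.sum_congr rfl fun i hi => ?_
      rw [if_neg (by have := (Finset.mem_Ico.1 hi).1; omega), hodd]
    rw [this]
    abel

include hν in
/-- Lévy's inequality for the largest summand. -/
lemma levy_term (n : ℕ) (t : ℝ) :
    Measure.infinitePi ν {x | ∃ j < n, t < ‖x j‖} ≤
      2 * Measure.infinitePi ν {x | t < ‖∑ i ∈ Finset.range n, x i‖} := by
  rcases Nat.eq_zero_or_pos n with rfl | hn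
  · simp
  have hE : ∀ j, MeasurableSet {x : ℕ → X | t < ‖x j‖} :=
    fun j => measurableSet_lt measurable_const (by fun_prop)
  have hset : {x : ℕ → X | ∃ j < n, t < ‖x j‖} =
      {x | ∃ j ≤ n - 1, x ∈ (fun j => {x : ℕ → X | t < ‖x j‖}) j} := by
    ext x
    simp only [Set.mem_ofPred_eq]
    exact exists_congr fun j => and_congr_left fun _ => by omega
  have hG : MeasurableSet {x : ℕ → X | t < ‖∑ i ∈ Finset.range n, x i‖} :=
    measurableSet_lt_norm_sum (φ := id) measurable_id _ _
  rw [hset]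
  refine measure_exists_le_of_firstHit hE hG fun j hj => ?_
  have key : ∀ (x : ℕ → X) (l : ℕ), ‖if l = j then x l else -x l‖ = ‖x l‖ := fun x l => by
    split_ifs <;> simp
  refine measure_le_two_mul_of_flip hν (fun i => i = j) (measurableSet_firstHit hE j) hG
    (fun x => ?_) fun x hx => ?_
  · simp only [firstHit, Set.mem_ofPred_eq, key, if_true]
  · refine lt_norm_or_lt_norm_of_add_eq (w := x j) ?_ hx.1
    have hjn : j ∈ Finset.range n := Finset.mem_range.2 (by omega)
    rw [← Finset.add_sum_erase _ _ hjn, ← Finset.add_sum_erase _ _ hjn, if_pos rfl]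
    have : ∑ i ∈ (Finset.range n).erase j, (if i = j then x i else -x i) =
        -∑ i ∈ (Finset.range n).erase j, x i := by
      rw [← Finset.sum_neg_distrib]
      exact Finset.sum_congr rfl fun i hi => if_neg (Finset.ne_of_mem_erase hi)
    rw [this]
    abel

/-- Truncation at level `a`. -/
noncomputable def trunc (a : ℝ) (x : X) : X := by classical exact if ‖x‖ ≤ a then x else 0

omit [NormedSpace ℝ X] [SecondCountableTopology X] in
lemma measurable_trunc (a : ℝ) : Measurable (trunc a : X → X) := by
  unfold trunc
  exact Measurable.ite (measurableSet_le (by fun_prop) measurable_const) measurable_id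
    measurable_const

omit [MeasurableSpace X] [BorelSpace X] [SecondCountableTopology X] [NormedSpace ℝ X] in
lemma trunc_neg (a : ℝ) (x : X) : trunc a (-x) = -trunc a x := by
  unfold trunc
  by_cases h : ‖x‖ ≤ a <;> simp [h]

omit [MeasurableSpace X] [BorelSpace X] [SecondCountableTopology X] [NormedSpace ℝ X] in
lemma norm_trunc_le {a : ℝ} (ha : 0 ≤ a) (x : X) : ‖trunc a x‖ ≤ a := by
  unfold trunc
  by_cases h : ‖x‖ ≤ a <;> simp [h, ha]

omit [MeasurableSpace X] [BorelSpace X] [SecondCountableTopology X] [NormedSpace ℝ X] in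
lemma trunc_of_le {a : ℝ} {x : X} (h : ‖x‖ ≤ a) : trunc a x = x := by
  simp [trunc, h]

include hν in
lemma measure_exceed_trunc_le (m : ℕ) (a t : ℝ) :
    Measure.infinitePi ν (exceed (trunc a) m t) ≤ 2 * Measure.infinitePi ν (exceed id m t) := by
  classical
  have hA : MeasurableSet {x : X | ‖x‖ ≤ a} := measurableSet_le (by fun_prop) measurable_const
  have hp := measurePreserving_infinitePi fun i =>
    measurePreserving_reflect (hν i) hA (fun x => by simp)
  have hE := measurableSet_exceed (X := X) (φ := id) measurable_id m t
  calc Measure.infinitePi ν (exceed (trunc a) m t)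
      ≤ Measure.infinitePi ν (exceed id m t ∪ (fun (x : ℕ → X) i =>
          if x i ∈ {x : X | ‖x‖ ≤ a} then x i else -x i) ⁻¹' exceed id m t) := by
        refine measure_mono fun x hx => ?_
        obtain ⟨j, hj, hlt⟩ := hx
        refine (lt_norm_or_lt_norm_of_add_eq (y := ∑ i ∈ Finset.range j, x i)
          (z := ∑ i ∈ Finset.range j, (if x i ∈ {x : X | ‖x‖ ≤ a} then x i else -x i)) ?_ hlt).imp
          (fun h => ⟨j, hj, h⟩) (fun h => ⟨j, hj, h⟩)
        · rw [← Finset.sum_add_distrib, ← Finset.sum_add_distrib]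
          refine Finset.sum_congr rfl fun i _ => ?_
          by_cases h : ‖x i‖ ≤ a <;> simp [trunc, h]
    _ ≤ _ := (measure_union_le _ _).trans_eq (by
        rw [hp.measure_preimage hE.nullMeasurableSet, two_mul])

include hν hφ hodd in
lemma measure_tail_le (m j : ℕ) (t : ℝ) :
    Measure.infinitePi ν {x | ∃ l ≤ m, t < ‖∑ i ∈ Finset.Ico j l, φ (x i)‖} ≤
      2 * Measure.infinitePi ν (exceed φ m t) := by
  have hp := measurePreserving_flip hν (fun i => j ≤ i)
  calc Measure.infinitePi ν {x | ∃ l ≤ m, t < ‖∑ i ∈ Finset.Ico j l, φ (x i)‖}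
      ≤ Measure.infinitePi ν (exceed φ m t ∪ (fun (x : ℕ → X) i =>
          if j ≤ i then x i else -x i) ⁻¹' exceed φ m t) := by
        refine measure_mono ?_
        rintro x ⟨l, hl, hlt⟩
        refine (lt_norm_or_lt_norm_of_add_eq (y := ∑ i ∈ Finset.range l, φ (x i))
          (z := ∑ i ∈ Finset.range l, φ (if j ≤ i then x i else -x i)) ?_ hlt).imp
          (fun h => ⟨l, hl, h⟩) (fun h => ⟨l, hl, h⟩)
        · rw [← Finset.sum_add_distrib, ← Finset.sum_add_distrib]
          have hsub : Finset.Ico j l ⊆ Finset.range l := fun i hi =>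
            Finset.mem_range.2 (Finset.mem_Ico.1 hi).2
          rw [← Finset.sum_subset hsub]
          · refine Finset.sum_congr rfl fun i hi => ?_
            rw [if_pos (Finset.mem_Ico.1 hi).1]
          · intro i hi hi'
            have : ¬ j ≤ i := fun h => hi' (Finset.mem_Ico.2 ⟨h, Finset.mem_range.1 hi⟩)
            rw [if_neg this, hodd, add_neg_cancel]
    _ ≤ _ := (measure_union_le _ _).trans_eq (by
        rw [hp.measure_preimage (measurableSet_exceed hφ m t).nullMeasurableSet, two_mul])

omit [NormedSpace ℝ X] [SecondCountableTopology X] [BorelSpace X] [NormedAddCommGroup X] in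
lemma indep_coordinates (S T : Set ℕ) (hST : Disjoint S T) :
    Indep (⨆ i ∈ S, MeasurableSpace.comap (fun x : ℕ → X => x i) inferInstance)
      (⨆ i ∈ T, MeasurableSpace.comap (fun x : ℕ → X => x i) inferInstance)
      (Measure.infinitePi ν) := by
  have h := iIndepFun_infinitePi (P := ν) (X := fun _ (x : X) => x) (fun _ => measurable_id)
  exact indep_iSup_of_disjoint (fun i => (measurable_pi_apply i).comap_le) h hST

omit [NormedSpace ℝ X] in
include hφ in
lemma measurable_sum_coordinates {S : Set ℕ} {s : Finset ℕ}
    (h : ∀ i ∈ s, i ∈ S) :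
    Measurable[⨆ i ∈ S, MeasurableSpace.comap (fun x : ℕ → X => x i) inferInstance]
      (fun x : ℕ → X => ∑ i ∈ s, φ (x i)) := by
  refine Finset.measurable_fun_sum s fun i hi => hφ.comp ?_
  exact (comap_measurable _).mono (le_iSup₂_of_le i (h i hi) le_rfl) le_rfl

include hν hφ hodd in
/-- Hoffmann-Jørgensen's inequality for bounded symmetric summands. -/
lemma hoffmannJorgensen {a : ℝ} (hbd : ∀ x, ‖φ x‖ ≤ a) (m : ℕ) {s : ℝ} (hs : 0 ≤ s) (t : ℝ)
    (ht : 0 ≤ t) :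
    Measure.infinitePi ν (exceed φ m (s + a + t)) ≤
      2 * Measure.infinitePi ν (exceed φ m t) * Measure.infinitePi ν (exceed φ m s) := by
  have ha : 0 ≤ a := (norm_nonneg _).trans (hbd 0)
  have hE : ∀ j, MeasurableSet {x : ℕ → X | s < ‖∑ i ∈ Finset.range j, φ (x i)‖} :=
    fun j => measurableSet_lt_norm_sum hφ _ _
  refine measure_le_mul_of_firstHit
    (E := fun j => {x : ℕ → X | s < ‖∑ i ∈ Finset.range j, φ (x i)‖}) hE ?_ fun j hj => ?_
  · rintro x ⟨j, hj, h⟩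
    exact ⟨j, hj, lt_of_le_of_lt (by linarith) h⟩
  have hT : MeasurableSet[⨆ i ∈ Set.Iio j,
      MeasurableSpace.comap (fun x : ℕ → X => x i) inferInstance]
      (firstHit (fun j => {x : ℕ → X | s < ‖∑ i ∈ Finset.range j, φ (x i)‖}) j) := by
    have : ∀ l ≤ j, MeasurableSet[⨆ i ∈ Set.Iio j,
        MeasurableSpace.comap (fun x : ℕ → X => x i) inferInstance]
        {x : ℕ → X | s < ‖∑ i ∈ Finset.range l, φ (x i)‖} := fun l hl =>
      measurable_sum_coordinates hφ (fun i hi => (Finset.mem_range.1 hi).trans_le hl)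
        (measurableSet_lt measurable_const measurable_norm)
    have h2 : firstHit (fun j => {x : ℕ → X | s < ‖∑ i ∈ Finset.range j, φ (x i)‖}) j =
        {x : ℕ → X | s < ‖∑ i ∈ Finset.range j, φ (x i)‖} ∩ ⋂ l ∈ Finset.range j,
          {x : ℕ → X | s < ‖∑ i ∈ Finset.range l, φ (x i)‖}ᶜ := by
      ext x; simp [firstHit]
    rw [h2]
    exact (this j le_rfl).inter (Finset.measurableSet_biInter _ fun l hl =>
      (this l (Finset.mem_range.1 hl).le).compl)
  have hR : MeasurableSet[⨆ i ∈ Set.Ici j,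
      MeasurableSpace.comap (fun x : ℕ → X => x i) inferInstance]
      {x : ℕ → X | ∃ l ≤ m, t < ‖∑ i ∈ Finset.Ico j l, φ (x i)‖} := by
    have h2 : {x : ℕ → X | ∃ l ≤ m, t < ‖∑ i ∈ Finset.Ico j l, φ (x i)‖} =
        ⋃ l ∈ Finset.range (m + 1), {x : ℕ → X | t < ‖∑ i ∈ Finset.Ico j l, φ (x i)‖} := by
      ext x; simp
    rw [h2]
    exact Finset.measurableSet_biUnion _ fun l _ =>
      measurable_sum_coordinates hφ (fun i hi => (Finset.mem_Ico.1 hi).1)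
        (measurableSet_lt measurable_const measurable_norm)
  have hind := (Indep_iff _ _ _).1 (indep_coordinates (ν := ν) (Set.Iio j) (Set.Ici j)
    (Set.disjoint_left.2 fun i hi hi' => absurd (Set.mem_Iio.1 hi) (not_lt.2 hi'))) _ _ hT hR
  calc _ ≤ Measure.infinitePi ν
        (firstHit (fun j => {x : ℕ → X | s < ‖∑ i ∈ Finset.range j, φ (x i)‖}) j ∩
          {x : ℕ → X | ∃ l ≤ m, t < ‖∑ i ∈ Finset.Ico j l, φ (x i)‖}) := by
        refine measure_mono ?_
        rintro x ⟨hx, l, hl, hlt⟩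
        refine ⟨hx, l, hl, ?_⟩
        have hj0 : j ≠ 0 := by
          rintro rfl
          have := hx.1
          simp only [Set.mem_ofPred_eq, Finset.range_zero, Finset.sum_empty, norm_zero] at this
          linarith
        obtain ⟨j', rfl⟩ := Nat.exists_eq_succ_of_ne_zero hj0
        have hle : ‖∑ i ∈ Finset.range (j' + 1), φ (x i)‖ ≤ s + a := by
          rw [Finset.sum_range_succ]
          refine (norm_add_le _ _).trans (add_le_add ?_ (hbd _))
          exact not_lt.1 (hx.2 j' (Nat.lt_succ_self _))
        have hjl : j' + 1 ≤ l := by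
          by_contra hc
          have h1 := hx.2 l (by omega)
          simp only [Set.mem_ofPred_eq, not_lt] at h1
          linarith
        rw [← Finset.sum_range_add_sum_Ico _ hjl] at hlt
        have := norm_add_le (∑ i ∈ Finset.range (j' + 1), φ (x i))
          (∑ i ∈ Finset.Ico (j' + 1) l, φ (x i))
        simp only [Nat.succ_eq_add_one]
        linarith
    _ ≤ _ := by
        rw [hind, mul_comm]
        exact mul_le_mul_left (measure_tail_le hν hφ hodd m j t) _

end SymmetricProduct

section Moments

variable {X : Type v} [NormedAddCommGroup X] [MeasurableSpace X] [BorelSpace X] [NormedSpace ℝ X]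
  [SecondCountableTopology X]
variable {ν : ℕ → Measure X} [∀ i, IsProbabilityMeasure (ν i)]
  (hν : ∀ i, MeasurePreserving (fun x : X => -x) (ν i) (ν i))
  {φ : X → X} (hφ : Measurable φ) (hodd : ∀ x, φ (-x) = -φ x)

/-- `c` is a constant of midpoint convexity for the power `p`. -/
def MidpointConst (p : ℝ) (c : ℝ≥0∞) : Prop :=
  ∀ x y z : ℝ≥0∞, 2 * z ≤ x + y → 2 * z ^ p ≤ c * (x ^ p + y ^ p)

lemma midpointConst_one {p : ℝ} (hp : 1 ≤ p) : MidpointConst p 1 := by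
  intro x y z h
  have hz : z ≤ 2⁻¹ * x + 2⁻¹ * y := by
    rw [← mul_add, ← ENNReal.mul_le_iff_le_inv (by norm_num) (by norm_num)]
    exact h
  have := (ENNReal.rpow_le_rpow hz (by linarith)).trans
    (ENNReal.rpow_arith_mean_le_arith_mean2_rpow 2⁻¹ 2⁻¹ x y ENNReal.inv_two_add_inv_two hp)
  rw [← mul_add, ← ENNReal.mul_le_iff_le_inv (by norm_num) (by norm_num)] at this
  simpa using this

lemma midpointConst_two {p : ℝ} (hp : 0 ≤ p) : MidpointConst p 2 := by
  intro x y z h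
  refine mul_le_mul_right ?_ 2
  have hz : z ≤ max x y := by
    have h2 : 2 * z ≤ 2 * max x y :=
      h.trans (by rw [two_mul]; exact add_le_add (le_max_left _ _) (le_max_right _ _))
    exact (ENNReal.mul_le_mul_iff_right (by norm_num) (by norm_num)).1 h2
  rcases le_total x y with hxy | hxy
  · rw [max_eq_right hxy] at hz
    exact (ENNReal.rpow_le_rpow hz hp).trans le_add_self
  · rw [max_eq_left hxy] at hz
    exact (ENNReal.rpow_le_rpow hz hp).trans le_self_add

include hν hφ hodd in
lemma lintegral_subsum_le {p : ℝ} {c : ℝ≥0∞} (hc : MidpointConst p c) {m : ℕ} {W : Finset ℕ}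
    (hW : W ⊆ Finset.range m) :
    ∫⁻ x, ‖∑ i ∈ W, φ (x i)‖ₑ ^ p ∂(Measure.infinitePi ν) ≤
      c * ∫⁻ x, ‖∑ i ∈ Finset.range m, φ (x i)‖ₑ ^ p ∂(Measure.infinitePi ν) := by
  have hp := measurePreserving_flip hν (fun i => i ∈ W)
  have hm : Measurable fun x : ℕ → X => ‖∑ i ∈ Finset.range m, φ (x i)‖ₑ ^ p := by fun_prop
  have h2 : 2 * ∫⁻ x, ‖∑ i ∈ W, φ (x i)‖ₑ ^ p ∂(Measure.infinitePi ν) ≤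
      2 * (c * ∫⁻ x, ‖∑ i ∈ Finset.range m, φ (x i)‖ₑ ^ p ∂(Measure.infinitePi ν)) := by
    rw [← lintegral_const_mul' _ _ (by norm_num)]
    calc ∫⁻ x, 2 * ‖∑ i ∈ W, φ (x i)‖ₑ ^ p ∂(Measure.infinitePi ν)
        ≤ ∫⁻ x, c * (‖∑ i ∈ Finset.range m, φ (x i)‖ₑ ^ p +
            ‖∑ i ∈ Finset.range m, φ (if i ∈ W then x i else -x i)‖ₑ ^ p)
            ∂(Measure.infinitePi ν) := by
          refine lintegral_mono fun x => hc _ _ _ ?_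
          have hsum : ∑ i ∈ Finset.range m, φ (x i) +
              ∑ i ∈ Finset.range m, φ (if i ∈ W then x i else -x i) =
              (2 : ℝ) • ∑ i ∈ W, φ (x i) := by
            rw [← Finset.sum_add_distrib, two_smul, ← Finset.sum_add_distrib,
              ← Finset.sum_subset hW]
            · exact Finset.sum_congr rfl fun i hi => by rw [if_pos hi]
            · intro i _ hi
              rw [if_neg hi, hodd, add_neg_cancel]
          refine le_trans (le_of_eq ?_) (enorm_add_le _ _)
          rw [hsum, enorm_smul]
          congr 1
          rw [Real.enorm_eq_ofReal (by norm_num)]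
          simp
      _ = c * (2 * ∫⁻ x, ‖∑ i ∈ Finset.range m, φ (x i)‖ₑ ^ p ∂(Measure.infinitePi ν)) := by
          rw [lintegral_const_mul _ (by
            refine hm.add (hm.comp hp.measurable)), lintegral_add_left hm]
          rw [hp.lintegral_comp (f := fun x => ‖∑ i ∈ Finset.range m, φ (x i)‖ₑ ^ p) hm, two_mul]
      _ = _ := by ring
  exact (ENNReal.mul_le_mul_iff_right (by norm_num) (by norm_num)).1 h2

/-- The moment constant produced by iterating Hoffmann-Jørgensen's inequality. -/
noncomputable def hjConst (p : ℝ) (ε : ℝ≥0∞) : ℝ≥0∞ :=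
  1 + ∑' k : ℕ, (2 * k + 3 : ℝ≥0∞) ^ p * (ε * (2 * ε) ^ k)

lemma two_mul_add_three_eq_ofReal (k : ℕ) : (2 * k + 3 : ℝ≥0∞) = ENNReal.ofReal (2 * k + 3) := by
  rw [ENNReal.ofReal_add (by positivity) (by positivity), ENNReal.ofReal_mul (by norm_num)]
  simp

include hν hφ hodd in
lemma measure_exceed_odd_mul_le {a : ℝ} (hbd : ∀ x, ‖φ x‖ ≤ a) {m : ℕ} {ε : ℝ≥0∞}
    (h : Measure.infinitePi ν (exceed φ m a) ≤ ε) (k : ℕ) :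
    Measure.infinitePi ν (exceed φ m ((2 * k + 1) * a)) ≤ ε * (2 * ε) ^ k := by
  have ha : 0 ≤ a := (norm_nonneg _).trans (hbd 0)
  induction k with
  | zero => simpa using h
  | succ k ih =>
    have := hoffmannJorgensen hν hφ hodd hbd m (s := (2 * k + 1) * a) (by positivity) a ha
    calc _ = Measure.infinitePi ν (exceed φ m ((2 * k + 1) * a + a + a)) := by
            congr 2; push_cast; ring
      _ ≤ _ := this
      _ ≤ 2 * ε * (ε * (2 * ε) ^ k) := by gcongr
      _ = _ := by ring

include hν hφ hodd in
lemma lintegral_sum_le_hjConst {p : ℝ} (hp : 0 ≤ p) {a : ℝ} (ha : 0 < a) (hbd : ∀ x, ‖φ x‖ ≤ a)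
    {m : ℕ} {ε : ℝ≥0∞} (h : Measure.infinitePi ν (exceed φ m a) ≤ ε) :
    ∫⁻ x, ‖∑ i ∈ Finset.range m, φ (x i)‖ₑ ^ p ∂(Measure.infinitePi ν) ≤
      ENNReal.ofReal a ^ p * hjConst p ε := by
  have hmeas := fun k : ℕ => measurableSet_lt_norm_sum (X := X) hφ (Finset.range m) ((2 * k + 1) * a)
  have hpt : ∀ x : ℕ → X, ‖∑ i ∈ Finset.range m, φ (x i)‖ₑ ^ p ≤ ENNReal.ofReal a ^ p +
      ∑' k : ℕ, {x : ℕ → X | (2 * k + 1) * a < ‖∑ i ∈ Finset.range m, φ (x i)‖}.indicator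
        (fun _ => ENNReal.ofReal a ^ p * (2 * k + 3 : ℝ≥0∞) ^ p) x := by
    intro x
    set y := ‖∑ i ∈ Finset.range m, φ (x i)‖ with hy
    have hye : ‖∑ i ∈ Finset.range m, φ (x i)‖ₑ = ENNReal.ofReal y := (ofReal_norm _).symm
    rw [hye]
    by_cases hya : y ≤ a
    · exact (ENNReal.rpow_le_rpow (ENNReal.ofReal_le_ofReal hya) hp).trans le_self_add
    · push Not at hya
      obtain ⟨k, hk⟩ : ∃ k : ℕ, (2 * k + 1) * a < y ∧ y ≤ (2 * k + 3) * a := by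
        have hex : ∃ k : ℕ, y ≤ (2 * k + 3) * a := by
          obtain ⟨k, hk⟩ := exists_nat_ge (y / a)
          refine ⟨k, ?_⟩
          rw [div_le_iff₀ ha] at hk
          have : (k : ℝ) * a ≤ (2 * k + 3) * a := by
            have : (0 : ℝ) ≤ k := Nat.cast_nonneg k
            nlinarith
          linarith
        classical
        refine ⟨Nat.find hex, ?_, Nat.find_spec hex⟩
        rcases Nat.eq_zero_or_pos (Nat.find hex) with h0 | h0
        · rw [h0]; simpa using hya
        · have := Nat.find_min hex (m := Nat.find hex - 1) (by omega)
          rw [not_le, Nat.cast_sub (by omega)] at this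
          push_cast at this
          linarith
      refine le_trans ?_ (le_trans (ENNReal.le_tsum k) le_add_self)
      rw [Set.indicator_of_mem (by exact hk.1), ← ENNReal.mul_rpow_of_nonneg _ _ hp]
      refine ENNReal.rpow_le_rpow ?_ hp
      rw [two_mul_add_three_eq_ofReal, ← ENNReal.ofReal_mul ha.le]
      exact ENNReal.ofReal_le_ofReal (by linarith [hk.2])
  refine (lintegral_mono hpt).trans ?_
  rw [lintegral_add_left measurable_const, lintegral_const, measure_univ, mul_one,
    lintegral_tsum fun k => (measurable_const.indicator (hmeas k)).aemeasurable, hjConst, mul_add,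
    mul_one, ← ENNReal.tsum_mul_left]
  refine add_le_add le_rfl (ENNReal.tsum_le_tsum fun k => ?_)
  rw [lintegral_indicator_const (hmeas k), mul_assoc]
  gcongr
  refine le_trans (measure_mono ?_) (measure_exceed_odd_mul_le hν hφ hodd hbd h k)
  exact fun x hx => ⟨m, le_rfl, hx⟩

include hν in
lemma lintegral_trunc_subsum_le {p : ℝ} (hp : 0 ≤ p) {c : ℝ≥0∞} (hc : MidpointConst p c) {a : ℝ}
    (ha : 0 < a) {m : ℕ} {ε : ℝ≥0∞} (h : Measure.infinitePi ν (exceed (trunc a) m a) ≤ ε)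
    {W : Finset ℕ} (hW : W ⊆ Finset.range m) :
    ∫⁻ x, ‖∑ i ∈ W, trunc a (x i)‖ₑ ^ p ∂(Measure.infinitePi ν) ≤
      c * (ENNReal.ofReal a ^ p * hjConst p ε) :=
  (lintegral_subsum_le hν (measurable_trunc a) (trunc_neg a) hc hW).trans
    (mul_le_mul_right (lintegral_sum_le_hjConst hν (measurable_trunc a) (trunc_neg a) hp ha
      (norm_trunc_le ha.le) h) c)

end Moments

section HJNumerics

lemma hasSum_odd_mul_geometric {r : ℝ} (h0 : 0 ≤ r) (h1 : r < 1) :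
    HasSum (fun k : ℕ => (2 * k + 3 : ℝ) * r ^ k) (2 * (r / (1 - r) ^ 2) + 3 * (1 - r)⁻¹) := by
  have hr : ‖r‖ < 1 := by rwa [Real.norm_of_nonneg h0]
  have := ((hasSum_coe_mul_geometric_of_norm_lt_one hr).mul_left 2).add
    ((hasSum_geometric_of_norm_lt_one hr).mul_left 3)
  have hfun : (fun k : ℕ => (2 * k + 3 : ℝ) * r ^ k) =
      fun k : ℕ => 2 * ((k : ℝ) * r ^ k) + 3 * r ^ k := by
    funext k; ring
  rw [hfun]
  exact this

lemma odd_mul_geometric_le_one (k : ℕ) : (2 * k + 3 : ℝ) * (3 / 5) ^ (k + 1) / 4 ≤ 1 := by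
  induction k with
  | zero => norm_num
  | succ k ih =>
    have hk : (0 : ℝ) ≤ k := Nat.cast_nonneg k
    have hpos : (0 : ℝ) < (3 / 5) ^ (k + 1) := by positivity
    rw [pow_succ]
    push_cast
    nlinarith

lemma hjConst_le {p : ℝ} (hp : 1 ≤ p) :
    hjConst p (ENNReal.ofReal ((3 / 5) ^ p / 2)) ≤ ENNReal.ofReal (11 / 8 * 4 ^ p) := by
  have hp0 : 0 ≤ p := by linarith
  have hsum := ((hasSum_odd_mul_geometric (r := 3 / 5) (by norm_num) (by norm_num)).mul_left
    (4 ^ p * (3 / 40)))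
  have hterm : ∀ k : ℕ, (2 * k + 3 : ℝ≥0∞) ^ p * (ENNReal.ofReal ((3 / 5) ^ p / 2) *
      (2 * ENNReal.ofReal ((3 / 5) ^ p / 2)) ^ k) ≤
      ENNReal.ofReal (4 ^ p * (3 / 40) * ((2 * k + 3) * (3 / 5) ^ k)) := by
    intro k
    have h2 : 2 * ENNReal.ofReal ((3 / 5 : ℝ) ^ p / 2) = ENNReal.ofReal ((3 / 5) ^ p) := by
      rw [← ENNReal.ofReal_ofNat, ← ENNReal.ofReal_mul (by norm_num)]
      congr 1; ring
    rw [h2, two_mul_add_three_eq_ofReal, ENNReal.ofReal_rpow_of_nonneg (by positivity) hp0,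
      ← ENNReal.ofReal_pow (by positivity), ← ENNReal.ofReal_mul (by positivity),
      ← ENNReal.ofReal_mul (by positivity)]
    refine ENNReal.ofReal_le_ofReal ?_
    have ht : ((2 * k + 3 : ℝ) * (3 / 5) ^ (k + 1) / 4) ^ p ≤
        (2 * k + 3 : ℝ) * (3 / 5) ^ (k + 1) / 4 :=
      (Real.rpow_le_rpow_of_exponent_ge' (by positivity) (odd_mul_geometric_le_one k)
        (by norm_num) hp).trans_eq (Real.rpow_one _)
    have heq : (2 * k + 3 : ℝ) ^ p * ((3 / 5) ^ p / 2 * ((3 / 5) ^ p) ^ k) =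
        4 ^ p / 2 * ((2 * k + 3 : ℝ) * (3 / 5) ^ (k + 1) / 4) ^ p := by
      rw [Real.div_rpow (x := (2 * k + 3 : ℝ) * (3 / 5) ^ (k + 1)) (by positivity) (by norm_num),
        Real.mul_rpow (by positivity) (by positivity), ← Real.rpow_natCast ((3 / 5 : ℝ)) (k + 1), ← Real.rpow_mul (by norm_num),
        mul_comm ((k + 1 : ℕ) : ℝ) p, Real.rpow_mul (by norm_num), Real.rpow_natCast, pow_succ]
      have : (4 : ℝ) ^ p ≠ 0 := by positivity
      field_simp
    rw [heq]
    calc _ ≤ (4 : ℝ) ^ p / 2 * ((2 * k + 3 : ℝ) * (3 / 5) ^ (k + 1) / 4) := by gcongr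
      _ = _ := by rw [pow_succ]; ring
  have h4 : (4 : ℝ) ≤ 4 ^ p := by
    simpa using Real.rpow_le_rpow_of_exponent_le (x := 4) (by norm_num) hp
  calc hjConst p (ENNReal.ofReal ((3 / 5) ^ p / 2))
      ≤ 1 + ∑' k : ℕ, ENNReal.ofReal (4 ^ p * (3 / 40) * ((2 * k + 3) * (3 / 5) ^ k)) := by
        exact add_le_add le_rfl (ENNReal.tsum_le_tsum hterm)
    _ = ENNReal.ofReal 1 + ENNReal.ofReal (4 ^ p * (9 / 8)) := by
        rw [← ENNReal.ofReal_tsum_of_nonneg (fun k => by positivity) hsum.summable, hsum.tsum_eq,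
          ENNReal.ofReal_one]
        norm_num [mul_assoc]
    _ ≤ _ := by
        rw [← ENNReal.ofReal_add (by norm_num) (by positivity)]
        exact ENNReal.ofReal_le_ofReal (by linarith)

lemma hjConst_ne_top {p : ℝ} (hp1 : p ≤ 1) : hjConst p 4⁻¹ ≠ ⊤ := by
  have hsum := ((hasSum_odd_mul_geometric (r := 1 / 2) (by norm_num) (by norm_num)).mul_left
    (1 / 4))
  refine ne_top_of_le_ne_top (b := 1 + ENNReal.ofReal _) (by simp) (add_le_add le_rfl
    ((ENNReal.tsum_le_tsum fun k => ?_).trans_eq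
      (ENNReal.ofReal_tsum_of_nonneg (fun k => by positivity) hsum.summable).symm))
  have h2 : (2 * 4⁻¹ : ℝ≥0∞) = ENNReal.ofReal (1 / 2) := by
    have h4 : (4⁻¹ : ℝ≥0∞) = ENNReal.ofReal (1 / 4) := by
      rw [one_div, ENNReal.ofReal_inv_of_pos (by norm_num)]; simp
    rw [h4, ← ENNReal.ofReal_ofNat, ← ENNReal.ofReal_mul (by norm_num)]
    norm_num
  have h4 : (4⁻¹ : ℝ≥0∞) = ENNReal.ofReal (1 / 4) := by
    rw [one_div, ENNReal.ofReal_inv_of_pos (by norm_num)]; simp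
  have h1 : (2 * k + 3 : ℝ≥0∞) ^ p ≤ 2 * k + 3 := by
    refine (ENNReal.rpow_le_rpow_of_exponent_le ?_ hp1).trans_eq (ENNReal.rpow_one _)
    exact le_trans (by norm_num) (le_add_self : (3 : ℝ≥0∞) ≤ 2 * k + 3)
  refine (mul_le_mul_left h1 _).trans_eq ?_
  rw [h2, h4, two_mul_add_three_eq_ofReal, ← ENNReal.ofReal_pow (by norm_num),
    ← ENNReal.ofReal_mul (by norm_num), ← ENNReal.ofReal_mul (by positivity)]
  congr 1
  ring

end HJNumerics

section Kernels

variable {Ω : Type u} {X : Type v} [mΩ : MeasurableSpace Ω] [NormedAddCommGroup X]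
  [MeasurableSpace X] [BorelSpace X] {μ : Measure Ω} {𝓕 : Filtration ℕ mΩ} {d e : ℕ → Ω → X}

/-- `κ i` is a version of the conditional law of `d (i + 1)` given `𝓕 i` all of whose values are
symmetric. -/
structure IsSymmCondLaw (μ : Measure Ω) (𝓕 : Filtration ℕ mΩ) (d : ℕ → Ω → X)
    (κ : ℕ → Ω → Measure X) : Prop where
  symm : ∀ i ω, MeasurePreserving (fun x : X => -x) (κ i ω) (κ i ω)
  meas : ∀ i B, MeasurableSet B → Measurable[𝓕 i] fun ω => κ i ω B
  law : ∀ i B, MeasurableSet B →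
    (fun ω => (κ i ω).real B) =ᵐ[μ] μ⟦d (i + 1) ⁻¹' B | 𝓕 i⟧

lemma exists_isSymmCondLaw [SecondCountableTopology X] [CompleteSpace X] [IsProbabilityMeasure μ]
    (hd : ∀ n, 1 ≤ n → Measurable (d n))
    (hsymm : ∀ n, 1 ≤ n → CondSymmetric μ (𝓕 (n - 1)) (d n)) :
    ∃ κ : ℕ → Ω → Measure X, (∀ i ω, IsProbabilityMeasure (κ i ω)) ∧ IsSymmCondLaw μ 𝓕 d κ := by
  have hid : ∀ i, @Measurable Ω Ω mΩ (𝓕 i) id := fun i => measurable_id'' (𝓕.le i)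
  let κ₀ : ∀ i, @Kernel Ω X (𝓕 i) _ := fun i =>
    @condDistrib Ω Ω X _ _ _ mΩ (𝓕 i) (d (i + 1)) id μ _
  have hκ₀ : ∀ i, @IsMarkovKernel Ω X (𝓕 i) _ (κ₀ i) := fun i => by
    dsimp only [κ₀]; infer_instance
  have hprob : ∀ i ω, IsProbabilityMeasure (κ₀ i ω) := fun i ω => (hκ₀ i).isProbabilityMeasure ω
  have hlaw₀ : ∀ i B, MeasurableSet B →
      (fun ω => (κ₀ i ω).real B) =ᵐ[μ] μ⟦d (i + 1) ⁻¹' B | 𝓕 i⟧ := fun i B hB => by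
    have := @condDistrib_ae_eq_condExp Ω Ω X _ _ _ mΩ μ _ id (d (i + 1)) (𝓕 i) B (hid i)
      (hd (i + 1) (by omega)) hB
    rwa [MeasurableSpace.comap_id] at this
  have hneg : Measurable fun x : X => -x := measurable_neg
  have happ : ∀ i ω B, MeasurableSet B →
      ((2⁻¹ : ℝ≥0∞) • (κ₀ i ω + (κ₀ i ω).map fun x => -x)) B =
        2⁻¹ * (κ₀ i ω B + κ₀ i ω ((fun x : X => -x) ⁻¹' B)) := fun i ω B hB => by
    rw [Measure.smul_apply, Measure.add_apply, Measure.map_apply hneg hB, smul_eq_mul]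
  refine ⟨fun i ω => (2⁻¹ : ℝ≥0∞) • (κ₀ i ω + (κ₀ i ω).map fun x => -x), fun i ω => ⟨?_⟩,
    fun i ω => ⟨hneg, ?_⟩, fun i B hB => ?_, fun i B hB => ?_⟩
  · rw [happ i ω _ .univ]
    simp [one_add_one_eq_two, ENNReal.inv_mul_cancel]
  · rw [Measure.map_smul, Measure.map_add _ _ hneg, Measure.map_map hneg hneg]
    have : ((fun x : X => -x) ∘ fun x : X => -x) = id := by funext x; simp
    rw [this, Measure.map_id, add_comm]
  · simp only [happ i _ B hB]
    have h1 := fun C (hC : MeasurableSet C) => @Kernel.measurable_coe Ω X (𝓕 i) _ (κ₀ i) C hC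
    exact ((h1 B hB).add (h1 _ (hneg hB))).const_mul _
  · have h1 := hlaw₀ i B hB
    have h2 := hlaw₀ i _ (hneg hB)
    have h3 := hsymm (i + 1) (by omega) B hB
    rw [Nat.add_sub_cancel] at h3
    filter_upwards [h1, h2, h3] with ω h1 h2 h3
    simp only [measureReal_def, happ i ω B hB] at h1 h2 ⊢
    rw [ENNReal.toReal_mul, ENNReal.toReal_add (measure_ne_top _ _) (measure_ne_top _ _), h1, h2]
    have h4 : (d (i + 1) ⁻¹' ((fun x : X => -x) ⁻¹' B)) = (fun ω => -d (i + 1) ω) ⁻¹' B := rfl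
    rw [h4, ← h3]
    simp only [ENNReal.toReal_inv, ENNReal.toReal_ofNat]
    ring

omit [NormedAddCommGroup X] [BorelSpace X] mΩ in
lemma measurable_infinitePi {m : MeasurableSpace Ω} {κ : ℕ → Ω → Measure X}
    [∀ i ω, IsProbabilityMeasure (κ i ω)]
    (hκ : ∀ i B, MeasurableSet B → Measurable fun ω => κ i ω B) :
    Measurable fun ω => Measure.infinitePi fun i => κ i ω := by
  refine Measurable.measure_of_isPiSystem_of_isProbabilityMeasure
    (generateFrom_squareCylinders (α := fun _ : ℕ => X)).symm
    (isPiSystem_squareCylinders (fun _ => MeasurableSpace.isPiSystem_measurableSet)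
      fun _ => MeasurableSet.univ) ?_
  rintro S ⟨s, t, ht, rfl⟩
  have ht' : ∀ i, MeasurableSet (t i) := fun i => ht i trivial
  simp only [Measure.infinitePi_pi _ fun i _ => ht' i]
  exact Finset.measurable_fun_prod _ fun i _ => hκ i _ (ht' i)

variable {κ : ℕ → Ω → Measure X} [∀ i ω, IsProbabilityMeasure (κ i ω)]

omit [BorelSpace X] in
lemma IsSymmCondLaw.measure_inter [IsProbabilityMeasure μ] (hκ : IsSymmCondLaw μ 𝓕 d κ)
    (hd : ∀ n, 1 ≤ n → Measurable (d n)) (i : ℕ) {A : Set Ω} (hA : MeasurableSet[𝓕 i] A)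
    {B : Set X} (hB : MeasurableSet B) :
    ∫⁻ ω in A, κ i ω B ∂μ = μ (A ∩ d (i + 1) ⁻¹' B) := by
  have hmE : MeasurableSet (d (i + 1) ⁻¹' B) := hd (i + 1) (by omega) hB
  have hint : Integrable ((d (i + 1) ⁻¹' B).indicator fun _ => (1 : ℝ)) μ :=
    (integrable_const _).indicator hmE
  have h := setIntegral_condExp (𝓕.le i) hint hA
  have h2 : ∫ ω in A, (κ i ω).real B ∂μ = μ.real (A ∩ d (i + 1) ⁻¹' B) := by
    rw [integral_congr_ae (ae_restrict_of_ae (hκ.law i B hB)), h,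
      integral_indicator_const _ hmE, measureReal_restrict_apply hmE, smul_eq_mul, mul_one,
      Set.inter_comm]
  have hm : Measurable fun ω => κ i ω B := (hκ.meas i B hB).mono (𝓕.le i) le_rfl
  simp only [measureReal_def] at h2
  rw [integral_toReal hm.aemeasurable (ae_of_all _ fun ω => measure_lt_top _ _)] at h2
  refine (ENNReal.toReal_eq_toReal_iff' ?_ (measure_ne_top _ _)).1 h2
  refine ne_top_of_le_ne_top (b := ∫⁻ ω in A, 1 ∂μ) (by simp) (lintegral_mono fun ω => prob_le_one)

omit [BorelSpace X] in
/-- The pull-out property of the conditional law. -/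
lemma IsSymmCondLaw.lintegral_mul [IsProbabilityMeasure μ] (hκ : IsSymmCondLaw μ 𝓕 d κ)
    (hd : ∀ n, 1 ≤ n → Measurable (d n)) (i : ℕ) {h : Ω → ℝ≥0∞} (hh : Measurable[𝓕 i] h)
    {B : Set X} (hB : MeasurableSet B) :
    ∫⁻ ω, κ i ω B * h ω ∂μ = ∫⁻ ω in d (i + 1) ⁻¹' B, h ω ∂μ := by
  have hmE : MeasurableSet (d (i + 1) ⁻¹' B) := hd (i + 1) (by omega) hB
  have hm : Measurable fun ω => κ i ω B := (hκ.meas i B hB).mono (𝓕.le i) le_rfl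
  have htrim : (μ.withDensity fun ω => κ i ω B).trim (𝓕.le i) =
      (μ.restrict (d (i + 1) ⁻¹' B)).trim (𝓕.le i) := by
    refine @Measure.ext _ (𝓕 i) _ _ fun A hA => ?_
    rw [trim_measurableSet_eq _ hA, trim_measurableSet_eq _ hA,
      withDensity_apply _ (𝓕.le i _ hA), hκ.measure_inter hd i hA hB,
      Measure.restrict_apply (𝓕.le i _ hA)]
  have h1 : ∫⁻ ω, κ i ω B * h ω ∂μ = ∫⁻ ω, h ω ∂(μ.withDensity fun ω => κ i ω B) := by
    rw [lintegral_withDensity_eq_lintegral_mul _ hm (hh.mono (𝓕.le i) le_rfl)]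
    rfl
  rw [h1, ← lintegral_trim (𝓕.le i) hh, htrim, lintegral_trim (𝓕.le i) hh]

omit [BorelSpace X] in
lemma map_restrict_eq_bind [IsProbabilityMeasure μ] (hκ : IsSymmCondLaw μ 𝓕 d κ)
    (he : IsDecoupledTangent μ 𝓕 d e) (hem : ∀ n, 1 ≤ n → Measurable (e n))
    {A : Set Ω} (hA : MeasurableSet[⨆ k, 𝓕 k] A) :
    (μ.restrict A).map (fun ω i => e (i + 1) ω) =
      (μ.restrict A).bind fun ω => Measure.infinitePi fun i => κ i ω := by
  have hle : (⨆ k, 𝓕 k) ≤ mΩ := iSup_le 𝓕.le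
  have hee : Measurable fun ω i => e (i + 1) ω :=
    measurable_pi_lambda _ fun i => hem (i + 1) (by omega)
  have hκm : ∀ i B, MeasurableSet B → Measurable fun ω => κ i ω B := fun i B hB =>
    (hκ.meas i B hB).mono (𝓕.le i) le_rfl
  have hQ := measurable_infinitePi hκm
  have hfin : IsFiniteMeasure ((μ.restrict A).map fun ω i => e (i + 1) ω) :=
    Measure.isFiniteMeasure_map _ _
  refine ext_of_generate_finite _
    (generateFrom_squareCylinders (α := fun _ : ℕ => X)).symm
    (isPiSystem_squareCylinders (fun _ => MeasurableSpace.isPiSystem_measurableSet)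
      fun _ => MeasurableSet.univ) ?_ ?_
  · rintro S ⟨s, t, ht, rfl⟩
    have ht' : ∀ i, MeasurableSet (t i) := fun i => ht i trivial
    have hS : MeasurableSet ((s : Set ℕ).pi t) := .pi s.countable_toSet fun i _ => ht' i
    rw [Measure.map_apply hee hS, Measure.bind_apply hS hQ.aemeasurable,
      Measure.restrict_apply (hee hS)]
    simp only [Measure.infinitePi_pi _ fun i _ => ht' i]
    obtain ⟨N, hN⟩ : ∃ N, s ⊆ Finset.range N := ⟨s.sup id + 1, fun i hi =>
      Finset.mem_range.2 (Nat.lt_succ_of_le (Finset.le_sup (f := id) hi))⟩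
    classical
    let B : ℕ → Set X := fun k => if k - 1 ∈ s then t (k - 1) else Set.univ
    have hB : ∀ k, MeasurableSet (B k) := fun k => by
      dsimp only [B]; split_ifs; exacts [ht' _, .univ]
    have hset : (fun ω i => e (i + 1) ω) ⁻¹' (s : Set ℕ).pi t =
        ⋂ k ∈ Finset.Icc 1 (N + 1), e k ⁻¹' B k := by
      ext ω
      simp only [Set.mem_preimage, Set.mem_pi, Finset.mem_coe, Set.mem_iInter, Finset.mem_Icc, B]
      constructor
      · intro h k hk
        by_cases hks : k - 1 ∈ s
        · have := h _ hks
          rw [Nat.sub_add_cancel hk.1] at this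
          simpa [hks] using this
        · simp [hks]
      · intro h i hi
        have := h (i + 1) ⟨by omega, by have := Finset.mem_range.1 (hN hi); omega⟩
        simpa [hi] using this
    have hE : MeasurableSet ((fun ω i => e (i + 1) ω) ⁻¹' (s : Set ℕ).pi t) := hee hS
    have hce : μ⟦(fun ω i => e (i + 1) ω) ⁻¹' (s : Set ℕ).pi t | ⨆ k, 𝓕 k⟧ =ᵐ[μ]
        fun ω => ∏ i ∈ s, (κ i ω).real (t i) := by
      rw [hset]
      have hk : ∀ᵐ ω ∂μ, ∀ k ∈ Finset.Icc 1 (N + 1),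
          (μ⟦e k ⁻¹' B k | ⨆ k, 𝓕 k⟧) ω = (κ (k - 1) ω).real (B k) := by
        rw [Filter.eventually_all_finset]
        intro k hk
        have hk1 := (Finset.mem_Icc.1 hk).1
        have h1 := hκ.law (k - 1) (B k) (hB k)
        rw [Nat.sub_add_cancel hk1] at h1
        filter_upwards [he.tangent k hk1 (B k) (hB k), h1] with ω h2 h1
        rw [← h2, ← h1]
      filter_upwards [he.condIndep (N + 1) (by omega) B hB, hk] with ω h1 h2
      rw [h1, Finset.prod_congr rfl h2]
      have : Finset.Icc 1 (N + 1) = (Finset.range (N + 1)).map ⟨(· + 1), add_left_injective 1⟩ := by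
        ext k; simp only [Finset.mem_Icc, Finset.mem_map, Finset.mem_range,
          Function.Embedding.coeFn_mk]
        exact ⟨fun h => ⟨k - 1, by omega, by omega⟩, by rintro ⟨a, h, rfl⟩; omega⟩
      rw [this, Finset.prod_map]
      simp only [Function.Embedding.coeFn_mk, Nat.add_sub_cancel, B]
      symm
      have hsub : s ⊆ Finset.range (N + 1) := hN.trans (Finset.range_mono (by omega))
      rw [← Finset.prod_subset hsub]
      · exact Finset.prod_congr rfl fun i hi => by simp [hi]
      · intro i _ hi
        simp [hi]
    have h := setIntegral_condExp (μ := μ) hle ((integrable_const (1 : ℝ)).indicator hE) hA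
    rw [integral_congr_ae (ae_restrict_of_ae hce), integral_indicator_const _ hE,
      measureReal_restrict_apply hE, smul_eq_mul, mul_one] at h
    have hpm : Measurable fun ω => ∏ i ∈ s, κ i ω (t i) :=
      Finset.measurable_fun_prod _ fun i _ => hκm i _ (ht' i)
    simp only [measureReal_def, ← ENNReal.toReal_prod] at h
    have hle1 : ∀ ω, ∏ i ∈ s, κ i ω (t i) ≤ 1 := fun ω => Finset.prod_le_one' fun i _ => prob_le_one
    rw [integral_toReal hpm.aemeasurable
      (ae_of_all _ fun ω => (hle1 ω).trans_lt ENNReal.one_lt_top)] at h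
    refine ((ENNReal.toReal_eq_toReal_iff' ?_ (measure_ne_top _ _)).1 h).symm
    exact ne_top_of_le_ne_top (b := ∫⁻ ω in A, 1 ∂μ) (by simp) (lintegral_mono hle1)
  · rw [Measure.map_apply hee .univ, Measure.bind_apply .univ hQ.aemeasurable]
    simp

omit [BorelSpace X] in
lemma setLIntegral_decoupled [IsProbabilityMeasure μ] (hκ : IsSymmCondLaw μ 𝓕 d κ)
    (he : IsDecoupledTangent μ 𝓕 d e) (hem : ∀ n, 1 ≤ n → Measurable (e n))
    {A : Set Ω} (hA : MeasurableSet[⨆ k, 𝓕 k] A) {F : (ℕ → X) → ℝ≥0∞} (hF : Measurable F) :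
    ∫⁻ ω in A, F (fun i => e (i + 1) ω) ∂μ =
      ∫⁻ ω in A, ∫⁻ x, F x ∂(Measure.infinitePi fun i => κ i ω) ∂μ := by
  have hee : Measurable fun ω i => e (i + 1) ω :=
    measurable_pi_lambda _ fun i => hem (i + 1) (by omega)
  have hκm : ∀ i B, MeasurableSet B → Measurable fun ω => κ i ω B := fun i B hB =>
    (hκ.meas i B hB).mono (𝓕.le i) le_rfl
  rw [← Measure.lintegral_bind (measurable_infinitePi hκm).aemeasurable hF.aemeasurable,
    ← map_restrict_eq_bind hκ he hem hA, lintegral_map hF hee]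

omit [BorelSpace X] in
lemma measure_decoupled [IsProbabilityMeasure μ] (hκ : IsSymmCondLaw μ 𝓕 d κ)
    (he : IsDecoupledTangent μ 𝓕 d e) (hem : ∀ n, 1 ≤ n → Measurable (e n))
    {C : Set (ℕ → X)} (hC : MeasurableSet C) :
    μ {ω | (fun i => e (i + 1) ω) ∈ C} = ∫⁻ ω, Measure.infinitePi (fun i => κ i ω) C ∂μ := by
  have hee : Measurable fun ω i => e (i + 1) ω :=
    measurable_pi_lambda _ fun i => hem (i + 1) (by omega)
  have hκm : ∀ i B, MeasurableSet B → Measurable fun ω => κ i ω B := fun i B hB =>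
    (hκ.meas i B hB).mono (𝓕.le i) le_rfl
  have h := map_restrict_eq_bind hκ he hem (A := Set.univ) MeasurableSet.univ
  rw [Measure.restrict_univ] at h
  rw [← Measure.bind_apply hC (measurable_infinitePi hκm).aemeasurable, ← h,
    Measure.map_apply hee hC]
  rfl

end Kernels

section Predictable

variable {Ω : Type u} {X : Type v} [mΩ : MeasurableSpace Ω] [NormedAddCommGroup X]
  [MeasurableSpace X] [BorelSpace X] {μ : Measure Ω} {𝓕 : Filtration ℕ mΩ} {d e : ℕ → Ω → X}
  {κ : ℕ → Ω → Measure X} [∀ i ω, IsProbabilityMeasure (κ i ω)]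

omit [BorelSpace X] in
/-- Events that depend on the coordinates `0, …, i` only have predictable probability. -/
lemma IsSymmCondLaw.measurable_infinitePi_apply (hκ : IsSymmCondLaw μ 𝓕 d κ) (i : ℕ)
    {C : Set (ℕ → X)} (hC : MeasurableSet C)
    (hinv : ∀ x : ℕ → X, (fun j => if j ≤ i then x j else 0) ∈ C ↔ x ∈ C) :
    Measurable[𝓕 i] fun ω => Measure.infinitePi (fun j => κ j ω) C := by
  let ψ : ℕ → X → X := fun j x => if j ≤ i then x else 0
  have hψ : ∀ j, Measurable (ψ j) := fun j => by
    dsimp only [ψ]; split_ifs <;> fun_prop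
  have : ∀ j ω, IsProbabilityMeasure ((κ j ω).map (ψ j)) := fun j ω =>
    Measure.isProbabilityMeasure_map (hψ j).aemeasurable
  have heq : ∀ ω, Measure.infinitePi (fun j => κ j ω) C =
      Measure.infinitePi (fun j => (κ j ω).map (ψ j)) C := fun ω => by
    rw [← Measure.infinitePi_map_pi _ hψ, Measure.map_apply (by fun_prop) hC]
    congr 1
    ext x
    exact (hinv x).symm
  simp only [heq]
  refine (Measure.measurable_coe hC).comp (measurable_infinitePi (m := 𝓕 i) fun j B hB => ?_)
  simp only [Measure.map_apply (hψ j) hB]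
  by_cases hj : j ≤ i
  · have : ψ j ⁻¹' B = B := by ext x; simp [ψ, hj]
    rw [this]
    exact (hκ.meas j B hB).mono (𝓕.mono hj) le_rfl
  · by_cases h0 : (0 : X) ∈ B
    · have : ψ j ⁻¹' B = Set.univ := by ext x; simp [ψ, hj, h0]
      simp [this]
    · have : ψ j ⁻¹' B = ∅ := by ext x; simp [ψ, hj, h0]
      simp [this]

/-- The largest term of a sequence is dominated by that of its decoupled tangent sequence. -/
lemma IsSymmCondLaw.measure_max_le [IsProbabilityMeasure μ] (hκ : IsSymmCondLaw μ 𝓕 d κ)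
    (hd : ∀ n, 1 ≤ n → Measurable[𝓕 n] (d n)) (n : ℕ) (t : ℝ) :
    μ {ω | ∃ i < n, t < ‖d (i + 1) ω‖} ≤
      2 * ∫⁻ ω, Measure.infinitePi (fun i => κ i ω) {x | ∃ i < n, t < ‖x i‖} ∂μ := by
  rcases Nat.eq_zero_or_pos n with rfl | hn
  · simp
  have hd' : ∀ n, 1 ≤ n → Measurable (d n) := fun n hn => (hd n hn).mono (𝓕.le n) le_rfl
  set B : Set X := {x | t < ‖x‖} with hBdef
  have hB : MeasurableSet B := measurableSet_lt measurable_const measurable_norm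
  set E : ℕ → Set Ω := fun i => d (i + 1) ⁻¹' B with hEdef
  have hE : ∀ i, MeasurableSet (E i) := fun i => hd' (i + 1) (by omega) hB
  set G : ℕ → Ω → ℝ≥0∞ := fun i ω => ∏ l ∈ Finset.range i, κ l ω Bᶜ with hG
  set R : ℕ → Ω → ℝ≥0∞ := fun i ω => 1 - G i ω with hR
  have hκB : ∀ i ω, κ i ω Bᶜ + κ i ω B = 1 := fun i ω => by
    rw [add_comm, measure_add_measure_compl hB, measure_univ]
  have hG1 : ∀ i ω, G i ω ≤ 1 := fun i ω => Finset.prod_le_one' fun l _ => prob_le_one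
  have hGstep : ∀ i ω, G i ω = G (i + 1) ω + κ i ω B * G i ω := fun i ω => by
    simp only [hG, Finset.prod_range_succ]
    rw [mul_comm (κ i ω B), ← mul_add, hκB, mul_one]
  have hGR : ∀ i ω, G i ω + R i ω = 1 := fun i ω => add_tsub_cancel_of_le (hG1 i ω)
  have hGanti : ∀ ω, Antitone fun i => G i ω := fun ω =>
    antitone_nat_of_succ_le fun i => by
      conv_rhs => rw [hGstep i ω]
      exact le_self_add
  have hGm : ∀ i, Measurable[𝓕 i] (G i) := fun i =>
    Finset.measurable_fun_prod _ fun l hl =>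
      (hκ.meas l _ hB.compl).mono (𝓕.mono (Finset.mem_range.1 hl).le) le_rfl
  have hRm : ∀ i, Measurable[𝓕 i] (R i) := fun i => (hGm i).const_sub 1
  have hsum : ∀ i ω, ∑ l ∈ Finset.range i, κ l ω B * G l ω + G i ω = 1 := fun i ω => by
    induction i with
    | zero => simp [hG]
    | succ i ih =>
      rw [Finset.sum_range_succ, add_assoc, add_comm (κ i ω B * G i ω), ← hGstep, ih]
  have hsum' : ∀ i ω, ∑ l ∈ Finset.range i, κ l ω B * G l ω = R i ω := fun i ω =>
    ENNReal.eq_sub_of_add_eq (ne_top_of_le_ne_top ENNReal.one_ne_top (hG1 i ω)) (hsum i ω)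
  have hQ : ∀ ω, Measure.infinitePi (fun i => κ i ω) {x | ∃ i < n, t < ‖x i‖} = R n ω := by
    intro ω
    have hset : {x : ℕ → X | ∃ i < n, t < ‖x i‖} =
        ((Finset.range n : Set ℕ).pi fun _ => Bᶜ)ᶜ := by
      ext x
      simp [Set.mem_pi, hBdef]
    rw [hset, prob_compl_eq_one_sub (.pi (Finset.countable_toSet _) fun _ _ => hB.compl),
      Measure.infinitePi_pi _ fun _ _ => hB.compl]
  simp only [hQ]
  have hN : ∀ i, MeasurableSet[𝓕 i] {ω | ∀ l < i, ω ∉ E l} := fun i => by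
    have : {ω | ∀ l < i, ω ∉ E l} = ⋂ l ∈ Finset.range i, (E l)ᶜ := by ext ω; simp
    rw [this]
    refine Finset.measurableSet_biInter _ fun l hl => MeasurableSet.compl ?_
    exact 𝓕.mono (Finset.mem_range.1 hl) _ (hd (l + 1) (by omega) hB)
  have hT : ∀ i, firstHit E i = {ω | ∀ l < i, ω ∉ E l} ∩ E i := fun i => by
    ext ω; simp [firstHit, and_comm]
  have hterm : ∀ i < n, μ (firstHit E i) ≤ ∫⁻ ω, κ i ω B * G i ω ∂μ +
      (μ.withDensity (R n)) (firstHit E i ∩ Set.univ) := by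
    intro i hi
    have hκm : Measurable fun ω => κ i ω B := (hκ.meas i B hB).mono (𝓕.le i) le_rfl
    have hRi : Measurable[𝓕 i] ({ω | ∀ l < i, ω ∉ E l}.indicator (R i)) :=
      (hRm i).indicator (hN i)
    rw [hT, ← hκ.measure_inter hd' i (hN i) hB, ← lintegral_indicator (𝓕.le i _ (hN i))]
    calc ∫⁻ ω, {ω | ∀ l < i, ω ∉ E l}.indicator (fun ω => κ i ω B) ω ∂μ
        ≤ ∫⁻ ω, κ i ω B * G i ω + κ i ω B * {ω | ∀ l < i, ω ∉ E l}.indicator (R i) ω ∂μ := by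
          refine lintegral_mono fun ω => ?_
          by_cases hω : ω ∈ {ω | ∀ l < i, ω ∉ E l}
          · simp only [Set.indicator_of_mem hω]
            rw [← mul_add, hGR, mul_one]
          · simp [Set.indicator_of_notMem hω]
      _ = ∫⁻ ω, κ i ω B * G i ω ∂μ + ∫⁻ ω in E i, {ω | ∀ l < i, ω ∉ E l}.indicator (R i) ω ∂μ := by
          rw [lintegral_add_left (by exact hκm.mul ((hGm i).mono (𝓕.le i) le_rfl)),
            hκ.lintegral_mul hd' i hRi hB]
      _ ≤ _ := by
          refine add_le_add le_rfl ?_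
          rw [lintegral_indicator (𝓕.le i _ (hN i)), Measure.restrict_restrict (𝓕.le i _ (hN i)),
            Set.inter_univ, withDensity_apply _ ((𝓕.le i _ (hN i)).inter (hE i))]
          exact lintegral_mono fun ω => tsub_le_tsub_left (hGanti ω hi.le) 1
  calc μ {ω | ∃ i < n, t < ‖d (i + 1) ω‖}
      ≤ ∑ i ∈ Finset.range (n - 1 + 1), μ (firstHit E i ∩ {ω | ∃ i < n, t < ‖d (i + 1) ω‖}) := by
        refine measure_le_sum_firstHit (E := E) ?_
        rintro ω ⟨i, hi, h⟩
        exact ⟨i, by omega, h⟩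
    _ ≤ ∑ i ∈ Finset.range (n - 1 + 1), (∫⁻ ω, κ i ω B * G i ω ∂μ +
          (μ.withDensity (R n)) (firstHit E i ∩ Set.univ)) :=
        Finset.sum_le_sum fun i hi => (measure_mono Set.inter_subset_left).trans
          (hterm i (by have := Finset.mem_range.1 hi; omega))
    _ ≤ ∫⁻ ω, R n ω ∂μ + (μ.withDensity (R n)) Set.univ := by
        rw [Finset.sum_add_distrib]
        refine add_le_add (le_of_eq ?_) (sum_measure_firstHit_inter_le hE .univ)
        rw [Nat.sub_add_cancel hn, ← lintegral_finsetSum]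
        · simp only [hsum']
        · intro i _
          exact ((hκ.meas i B hB).mono (𝓕.le i) le_rfl).mul ((hGm i).mono (𝓕.le i) le_rfl)
    _ = _ := by rw [withDensity_apply _ .univ, Measure.restrict_univ, two_mul]

end Predictable

section Transform

variable {Ω : Type u} {X : Type v} [mΩ : MeasurableSpace Ω] {μ : Measure Ω}

lemma condExp_indicator_congr_on [IsFiniteMeasure μ] {m : MeasurableSpace Ω}
    {V E E' : Set Ω} (hV : MeasurableSet[m] V) (hE : MeasurableSet[mΩ] E)
    (hE' : MeasurableSet[mΩ] E')
    (h : ∀ ω ∈ V, ω ∈ E ↔ ω ∈ E') :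
    ∀ᵐ ω ∂μ, ω ∈ V → (μ⟦E | m⟧) ω = (μ⟦E' | m⟧) ω := by
  have h1 := condExp_indicator (m := m) ((integrable_const (μ := μ) (1 : ℝ)).indicator hE) hV
  have h2 := condExp_indicator (m := m) ((integrable_const (μ := μ) (1 : ℝ)).indicator hE') hV
  have heq : V.indicator (E.indicator fun _ => (1 : ℝ)) =
      V.indicator (E'.indicator fun _ => (1 : ℝ)) := by
    ext ω
    by_cases hω : ω ∈ V
    · by_cases hωE : ω ∈ E
      · simp [hω, hωE, (h ω hω).1 hωE]
      · simp [hω, hωE, (h ω hω).not.1 hωE]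
    · simp [hω]
  rw [heq] at h1
  filter_upwards [h1, h2] with ω h1 h2 hω
  rw [h1] at h2
  simpa [hω] using h2

lemma condExp_indicator_prop [IsProbabilityMeasure μ] {m : MeasurableSpace Ω} (hm : m ≤ mΩ)
    (P : Prop) [Decidable P] :
    μ⟦{_ω : Ω | P} | m⟧ = fun _ => if P then (1 : ℝ) else 0 := by
  have : ({_ω : Ω | P}.indicator fun _ => (1 : ℝ)) = fun _ => if P then (1 : ℝ) else 0 := by
    ext ω; by_cases hP : P <;> simp [hP]
  rw [this, condExp_const hm]

variable [NormedAddCommGroup X]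

/-- The transform `∑ i < j, 1_{V i} φ(f (i + 1) - f i)` of `f`. -/
noncomputable def transform (V : ℕ → Set Ω) (φ : X → X) (f : ℕ → Ω → X) (j : ℕ) (ω : Ω) : X :=
  ∑ i ∈ Finset.range j, (V i).indicator (fun ω => φ (diffSeq f (i + 1) ω)) ω

omit mΩ in
lemma diffSeq_transform (V : ℕ → Set Ω) (φ : X → X) (f : ℕ → Ω → X) {n : ℕ} (hn : 1 ≤ n) :
    diffSeq (transform V φ f) n = (V (n - 1)).indicator (fun ω => φ (diffSeq f n ω)) := by
  obtain ⟨k, rfl⟩ : ∃ k, n = k + 1 := ⟨n - 1, by omega⟩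
  ext ω
  simp [diffSeq, transform, Finset.sum_range_succ]

variable [MeasurableSpace X] [BorelSpace X] {𝓕 : Filtration ℕ mΩ}

lemma IsDecoupledSum.transform [IsProbabilityMeasure μ] [SecondCountableTopology X]
    {f g : ℕ → Ω → X} (hg : IsDecoupledSum μ 𝓕 f g)
    (hf : ∀ n, 1 ≤ n → Measurable (diffSeq f n)) {V : ℕ → Set Ω}
    (hV : ∀ i, MeasurableSet[𝓕 i] (V i)) {φ : X → X} (hφ : Measurable φ) :
    IsDecoupledSum μ 𝓕 (transform V φ f) (transform V φ g) := by
  classical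
  have hle : (⨆ k, 𝓕 k) ≤ mΩ := iSup_le 𝓕.le
  have hV' : ∀ i, MeasurableSet[⨆ k, 𝓕 k] (V i) := fun i => le_iSup 𝓕 i _ (hV i)
  have hgm : ∀ n, 1 ≤ n → Measurable (diffSeq g n) := fun n hn =>
    (hg.2.stronglyMeasurable n hn).measurable
  have htm : ∀ h : ℕ → Ω → X, (∀ n, 1 ≤ n → Measurable (diffSeq h n)) → ∀ n, 1 ≤ n →
      Measurable (diffSeq (Decoupling.transform V φ h) n) := fun h hh n hn => by
    rw [diffSeq_transform V φ h hn]
    exact (hφ.comp (hh n hn)).indicator (𝓕.le _ _ (hV _))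
  -- the transformed difference, on `V` and off `V`
  have hon : ∀ h : ℕ → Ω → X, ∀ n, 1 ≤ n → ∀ B : Set X, ∀ ω ∈ V (n - 1),
      ω ∈ diffSeq (Decoupling.transform V φ h) n ⁻¹' B ↔ ω ∈ diffSeq h n ⁻¹' (φ ⁻¹' B) :=
    fun h n hn B ω hω => by
      rw [Set.mem_preimage, diffSeq_transform V φ h hn, Set.indicator_of_mem hω]; rfl
  have hoff : ∀ h : ℕ → Ω → X, ∀ n, 1 ≤ n → ∀ B : Set X, ∀ ω ∈ (V (n - 1))ᶜ,
      ω ∈ diffSeq (Decoupling.transform V φ h) n ⁻¹' B ↔ ω ∈ {_ω : Ω | (0 : X) ∈ B} :=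
    fun h n hn B ω hω => by
      rw [Set.mem_preimage, diffSeq_transform V φ h hn, Set.indicator_of_notMem hω]; rfl
  have hconst : ∀ P : Prop, MeasurableSet {_ω : Ω | P} := fun P => MeasurableSet.const P
  refine ⟨by ext ω; simp [Decoupling.transform], fun n hn => (htm g hgm n hn).stronglyMeasurable,
    fun n hn B hB => ?_, fun n hn B hB => ?_⟩
  · have h1 := condExp_indicator_congr_on (μ := μ) (hV (n - 1))
      (htm f hf n hn hB) (hf n hn (hφ hB)) (hon f n hn B)
    have h2 := condExp_indicator_congr_on (μ := μ) (hV' (n - 1))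
      (htm g hgm n hn hB) (hgm n hn (hφ hB)) (hon g n hn B)
    have h3 := condExp_indicator_congr_on (μ := μ) (hV (n - 1)).compl
      (htm f hf n hn hB) (hconst _) (hoff f n hn B)
    have h4 := condExp_indicator_congr_on (μ := μ) (hV' (n - 1)).compl
      (htm g hgm n hn hB) (hconst _) (hoff g n hn B)
    filter_upwards [h1, h2, h3, h4, hg.2.tangent n hn _ (hφ hB)] with ω h1 h2 h3 h4 h5
    by_cases hω : ω ∈ V (n - 1)
    · rw [h1 hω, h2 hω, h5]
    · rw [h3 hω, h4 hω, condExp_indicator_prop (𝓕.le _), condExp_indicator_prop hle]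
  · -- condition on the pattern `{k | ω ∈ V (k - 1)}`
    let B' : Finset ℕ → ℕ → Set X := fun W k => if k ∈ W then φ ⁻¹' B k else {_x | (0 : X) ∈ B k}
    have hB' : ∀ W k, MeasurableSet (B' W k) := fun W k => by
      dsimp only [B']; split_ifs; exacts [hφ (hB k), MeasurableSet.const _]
    let A : Finset ℕ → Set Ω := fun W => ⋂ k ∈ Finset.Icc 1 n, {ω | ω ∈ V (k - 1) ↔ k ∈ W}
    have hA : ∀ W, MeasurableSet[⨆ k, 𝓕 k] (A W) := fun W =>
      Finset.measurableSet_biInter _ fun k _ => by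
        by_cases hk : k ∈ W
        · simp only [hk, iff_true]; exact hV' (k - 1)
        · simp only [hk, iff_false]; exact (hV' (k - 1)).compl
    have hAk : ∀ W, ∀ ω ∈ A W, ∀ k ∈ Finset.Icc 1 n,
        (ω ∈ diffSeq (Decoupling.transform V φ g) k ⁻¹' B k ↔ ω ∈ diffSeq g k ⁻¹' B' W k) := by
      intro W ω hω k hk
      have hk1 := (Finset.mem_Icc.1 hk).1
      have hiff : ω ∈ V (k - 1) ↔ k ∈ W := by
        have := Set.mem_iInter₂.1 hω k hk
        exact this
      by_cases hkW : k ∈ W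
      · rw [hon g k hk1 (B k) ω (hiff.2 hkW)]
        simp [B', hkW]
      · rw [hoff g k hk1 (B k) ω (fun h => hkW (hiff.1 h))]
        simp [B', hkW]
    have hall : ∀ᵐ ω ∂μ, ∀ W ∈ (Finset.Icc 1 n).powerset, ω ∈ A W →
        (μ⟦⋂ k ∈ Finset.Icc 1 n, diffSeq (Decoupling.transform V φ g) k ⁻¹' B k | ⨆ k, 𝓕 k⟧) ω =
          ∏ k ∈ Finset.Icc 1 n,
            (μ⟦diffSeq (Decoupling.transform V φ g) k ⁻¹' B k | ⨆ k, 𝓕 k⟧) ω := by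
      rw [Filter.eventually_all_finset]
      intro W _
      have h1 := condExp_indicator_congr_on (μ := μ) (hA W)
        (E := ⋂ k ∈ Finset.Icc 1 n, diffSeq (Decoupling.transform V φ g) k ⁻¹' B k)
        (E' := ⋂ k ∈ Finset.Icc 1 n, diffSeq g k ⁻¹' B' W k)
        (Finset.measurableSet_biInter _ fun k hk => htm g hgm k (Finset.mem_Icc.1 hk).1 (hB k))
        (Finset.measurableSet_biInter _ fun k hk => hgm k (Finset.mem_Icc.1 hk).1 (hB' W k))
        (fun ω hω => by
          simp only [Set.mem_iInter]
          exact forall₂_congr fun k hk => hAk W ω hω k hk)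
      have h2 : ∀ᵐ ω ∂μ, ∀ k ∈ Finset.Icc 1 n, ω ∈ A W →
          (μ⟦diffSeq (Decoupling.transform V φ g) k ⁻¹' B k | ⨆ k, 𝓕 k⟧) ω =
            (μ⟦diffSeq g k ⁻¹' B' W k | ⨆ k, 𝓕 k⟧) ω := by
        rw [Filter.eventually_all_finset]
        intro k hk
        exact condExp_indicator_congr_on (hA W) (htm g hgm k (Finset.mem_Icc.1 hk).1 (hB k))
          (hgm k (Finset.mem_Icc.1 hk).1 (hB' W k)) fun ω hω => hAk W ω hω k hk
      filter_upwards [h1, h2, hg.2.condIndep n hn (B' W) (hB' W)] with ω h1 h2 h3 hω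
      rw [h1 hω, h3]
      exact (Finset.prod_congr rfl fun k hk => h2 k hk hω).symm
    filter_upwards [hall] with ω h
    refine h ((Finset.Icc 1 n).filter fun k => ω ∈ V (k - 1))
      (Finset.mem_powerset.2 (Finset.filter_subset _ _)) ?_
    refine Set.mem_iInter₂.2 fun k hk => ?_
    simp only [Set.mem_ofPred_eq, Finset.mem_filter]
    exact ⟨fun h => ⟨hk, h⟩, fun h => h.2⟩

end Transform

section TransformLemmas

variable {Ω : Type u} {X : Type v} [NormedAddCommGroup X] {V V' : ℕ → Set Ω} {φ : X → X}
  {f : ℕ → Ω → X} {ω : Ω}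

lemma transform_eq_of_stop {n k : ℕ} (hk : k ≤ n) (h : ∀ i, ω ∈ V' i ↔ ω ∈ V i ∧ i < k) :
    transform V' φ f n ω = transform V φ f k ω := by
  classical
  unfold transform
  rw [← Finset.sum_subset (Finset.range_mono hk)]
  · refine Finset.sum_congr rfl fun i hi => ?_
    have := h i
    simp only [Finset.mem_range.1 hi, and_true] at this
    simp only [Set.indicator_apply, this]
  · intro i _ hi
    refine Set.indicator_of_notMem (fun hV => hi ?_) _
    exact Finset.mem_range.2 ((h i).1 hV).2

lemma transform_eq_of_start {j m : ℕ} (hm : m ≤ j) (h : ∀ i, ω ∈ V' i ↔ ω ∈ V i ∧ m ≤ i) :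
    transform V φ f j ω = transform V φ f m ω + transform V' φ f j ω := by
  classical
  unfold transform
  rw [← Finset.sum_range_add_sum_Ico _ hm]
  congr 1
  have hsub : Finset.Ico m j ⊆ Finset.range j := fun i hi =>
    Finset.mem_range.2 (Finset.mem_Ico.1 hi).2
  rw [← Finset.sum_subset hsub]
  · refine Finset.sum_congr rfl fun i hi => ?_
    have := h i
    simp only [(Finset.mem_Ico.1 hi).1, and_true] at this
    simp only [Set.indicator_apply, this]
  · intro i hi hi'
    refine Set.indicator_of_notMem (fun hV => hi' ?_) _
    exact Finset.mem_Ico.2 ⟨((h i).1 hV).2, Finset.mem_range.1 hi⟩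

lemma eq_sum_diffSeq (h0 : f 0 = 0) (n : ℕ) (ω : Ω) :
    f n ω = ∑ i ∈ Finset.range n, diffSeq f (i + 1) ω := by
  simp only [diffSeq, Nat.add_sub_cancel]
  rw [Finset.sum_range_sub (fun i => f i ω) n, h0]
  simp

lemma transform_trunc_eq (h0 : f 0 = 0) {a : ℝ} {n j : ℕ} (hj : j ≤ n)
    (hV : ∀ i < n, ω ∈ V i) (ha : ∀ i < n, ‖diffSeq f (i + 1) ω‖ ≤ a) :
    transform V (trunc a) f j ω = f j ω := by
  rw [eq_sum_diffSeq h0, transform]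
  refine Finset.sum_congr rfl fun i hi => ?_
  have hi' := (Finset.mem_range.1 hi).trans_le hj
  rw [Set.indicator_of_mem (hV i hi'), trunc_of_le (ha i hi')]

lemma norm_indicator_trunc_le {a : ℝ} (ha : 0 ≤ a) (i : ℕ) :
    ‖(V i).indicator (fun ω => trunc a (diffSeq f (i + 1) ω)) ω‖ ≤ a :=
  (norm_indicator_le_norm_self _ _).trans (norm_trunc_le ha _)

lemma norm_transform_trunc_le {a : ℝ} (ha : 0 ≤ a) (n : ℕ) :
    ‖transform V (trunc a) f n ω‖ ≤ n * a := by
  refine (norm_sum_le_of_le _ fun i _ => norm_indicator_trunc_le ha i).trans ?_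
  simp

lemma exists_lt_norm_stopped {a s h : ℝ} (ha : 0 ≤ a) (hs : 0 ≤ s) (hh : 0 < h) {n : ℕ}
    {G : ℕ → Set Ω} (hω : ∃ j ≤ n, s + a + h < ‖transform G (trunc a) f j ω‖) :
    h < ‖transform (fun i => G i ∩ {ω | ∃ j ≤ i, s < ‖transform G (trunc a) f j ω‖} ∩
      {ω | ∀ l ≤ i, ‖transform (fun i => G i ∩
        {ω | ∃ j ≤ i, s < ‖transform G (trunc a) f j ω‖}) (trunc a) f l ω‖ ≤ h})
      (trunc a) f n ω‖ := by
  classical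
  obtain ⟨j, hj, hlt⟩ := hω
  have hex : ∃ m, s < ‖transform G (trunc a) f m ω‖ := ⟨j, by linarith⟩
  set m := Nat.find hex with hm
  have hm1 : s < ‖transform G (trunc a) f m ω‖ := Nat.find_spec hex
  have hm2 : ∀ i < m, ‖transform G (trunc a) f i ω‖ ≤ s := fun i hi =>
    not_lt.1 (Nat.find_min hex hi)
  have hmle : ‖transform G (trunc a) f m ω‖ ≤ s + a := by
    rcases Nat.eq_zero_or_pos m with h0 | h0
    · rw [h0]
      simp only [transform, Finset.range_zero, Finset.sum_empty, norm_zero]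
      linarith
    · obtain ⟨k, hk⟩ : ∃ k, m = k + 1 := ⟨m - 1, by omega⟩
      have h1 := hm2 k (by omega)
      rw [hk]
      unfold transform at h1 ⊢
      rw [Finset.sum_range_succ]
      exact (norm_add_le _ _).trans (add_le_add h1 (norm_indicator_trunc_le ha k))
  have hmj : m ≤ j := by
    by_contra hc
    have := hm2 j (by omega)
    linarith
  have hU : ∀ i, (ω ∈ G i ∩ {ω | ∃ j ≤ i, s < ‖transform G (trunc a) f j ω‖}) ↔
      ω ∈ G i ∧ m ≤ i := fun i => by
    refine and_congr_right fun _ => ⟨?_, fun h => ⟨m, h, hm1⟩⟩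
    rintro ⟨l, hl, hl'⟩
    exact (Nat.find_min' hex hl').trans hl
  have hstart := transform_eq_of_start (φ := trunc a) (f := f) hmj hU
  have hex2 : ∃ l, h < ‖transform (fun i => G i ∩
      {ω | ∃ j ≤ i, s < ‖transform G (trunc a) f j ω‖}) (trunc a) f l ω‖ := by
    refine ⟨j, ?_⟩
    rw [hstart] at hlt
    linarith [norm_add_le (transform G (trunc a) f m ω) (transform (fun i => G i ∩
      {ω | ∃ j ≤ i, s < ‖transform G (trunc a) f j ω‖}) (trunc a) f j ω)]
  set k := Nat.find hex2 with hk
  have hkj : k ≤ j := Nat.find_min' hex2 (by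
    rw [hstart] at hlt
    linarith [norm_add_le (transform G (trunc a) f m ω) (transform (fun i => G i ∩
      {ω | ∃ j ≤ i, s < ‖transform G (trunc a) f j ω‖}) (trunc a) f j ω)])
  rw [transform_eq_of_stop (V := fun i => G i ∩
      {ω | ∃ j ≤ i, s < ‖transform G (trunc a) f j ω‖}) (hkj.trans hj)]
  · exact Nat.find_spec hex2
  · intro i
    refine and_congr_right fun _ => ⟨fun hl => ?_, fun hi l hl => ?_⟩
    · by_contra hc
      exact absurd (Nat.find_spec hex2) (not_lt.2 (hl k (not_lt.1 hc)))
    · exact not_lt.1 (Nat.find_min hex2 (hl.trans_lt hi))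

variable [mΩ : MeasurableSpace Ω] [MeasurableSpace X] [BorelSpace X] [SecondCountableTopology X]
  {𝓕 : Filtration ℕ mΩ}

lemma measurable_transform (hV : ∀ i, MeasurableSet[𝓕 i] (V i)) (hφ : Measurable φ)
    (hf : ∀ n, 1 ≤ n → Measurable[𝓕 n] (diffSeq f n)) (j : ℕ) :
    Measurable[𝓕 j] (transform V φ f j) := by
  refine Finset.measurable_fun_sum _ fun i hi => ?_
  have hij : i + 1 ≤ j := Finset.mem_range.1 hi
  refine Measurable.indicator ?_ (𝓕.mono (by omega) _ (hV i))
  exact hφ.comp ((hf (i + 1) (by omega)).mono (𝓕.mono hij) le_rfl)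

lemma measurableSet_exists_lt_transform (hV : ∀ i, MeasurableSet[𝓕 i] (V i)) (hφ : Measurable φ)
    (hf : ∀ n, 1 ≤ n → Measurable[𝓕 n] (diffSeq f n)) (i : ℕ) (s : ℝ) :
    MeasurableSet[𝓕 i] {ω | ∃ j ≤ i, s < ‖transform V φ f j ω‖} := by
  have : {ω | ∃ j ≤ i, s < ‖transform V φ f j ω‖} =
      ⋃ j ∈ Finset.range (i + 1), {ω | s < ‖transform V φ f j ω‖} := by
    ext ω; simp
  rw [this]
  refine Finset.measurableSet_biUnion _ fun j hj => ?_
  have hm := (measurable_transform hV hφ hf j).mono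
    (𝓕.mono (Nat.lt_succ_iff.1 (Finset.mem_range.1 hj))) le_rfl
  exact hm (measurableSet_lt measurable_const measurable_norm)

end TransformLemmas

section GoodLambda

variable {Ω : Type u} {X : Type v} [mΩ : MeasurableSpace Ω] [NormedAddCommGroup X]
  [NormedSpace ℝ X] [MeasurableSpace X] [BorelSpace X] [SecondCountableTopology X]
  {μ : Measure Ω} [IsProbabilityMeasure μ] {𝓕 : Filtration ℕ mΩ} {f g : ℕ → Ω → X}
  {κ : ℕ → Ω → Measure X} [∀ i ω, IsProbabilityMeasure (κ i ω)] {p : ℝ} {D : ℝ≥0} {c ε : ℝ≥0∞}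
  {a : ℝ}

/-- The event that, conditionally, the truncated decoupled sums up to time `i + 1` exceed `a` with
probability at most `ε`. -/
def goodSet (κ : ℕ → Ω → Measure X) [∀ i ω, IsProbabilityMeasure (κ i ω)] (a : ℝ) (ε : ℝ≥0∞)
    (i : ℕ) : Set Ω :=
  {ω | Measure.infinitePi (fun i => κ i ω) (exceed (trunc a) (i + 1) a) ≤ ε}

omit [IsProbabilityMeasure μ] [NormedSpace ℝ X] in
lemma measurableSet_goodSet (hκ : IsSymmCondLaw μ 𝓕 (diffSeq f) κ) (i : ℕ) :
    MeasurableSet[𝓕 i] (goodSet κ a ε i) := by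
  have := hκ.measurable_infinitePi_apply i
    (measurableSet_exceed (X := X) (measurable_trunc a) (i + 1) a) fun x => by
      simp only [exceed, Set.mem_ofPred_eq]
      refine exists_congr fun j => and_congr_right fun hj => ?_
      have : ∑ l ∈ Finset.range j, trunc a (if l ≤ i then x l else 0) =
          ∑ l ∈ Finset.range j, trunc a (x l) := Finset.sum_congr rfl fun l hl => by
        rw [if_pos (by have := Finset.mem_range.1 hl; omega)]
      rw [this]
  exact this measurableSet_Iic

omit [NormedSpace ℝ X] [BorelSpace X] [SecondCountableTopology X] in
lemma lintegral_le_of_decouplingWith (hX : DecouplingWith.{u, v} X p D) (hp : 0 < p)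
    [μ.IsComplete] (h0 : 𝓕 0 = ⊥) {f g : ℕ → Ω → X} (hf0 : f 0 = 0) (hf : StronglyAdapted 𝓕 f)
    (hmem : ∀ n, MemLp (f n) (ENNReal.ofReal p) μ) (hg : IsDecoupledSum μ 𝓕 f g) {n : ℕ}
    (hn : 1 ≤ n) :
    ∫⁻ ω, ‖f n ω‖ₑ ^ p ∂μ ≤ (D : ℝ≥0∞) ^ p * ∫⁻ ω, ‖g n ω‖ₑ ^ p ∂μ := by
  have h := hX Ω μ 𝓕 f g h0 hf0 hf hmem hg n hn
  have hp0 : ENNReal.ofReal p ≠ 0 := by simpa using hp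
  rw [eLpNorm_eq_lintegral_rpow_enorm_toReal hp0 ENNReal.ofReal_ne_top,
    eLpNorm_eq_lintegral_rpow_enorm_toReal hp0 ENNReal.ofReal_ne_top,
    ENNReal.toReal_ofReal hp.le] at h
  have h2 := ENNReal.rpow_le_rpow h hp.le
  rw [ENNReal.mul_rpow_of_nonneg _ _ hp.le, ← ENNReal.rpow_mul, ← ENNReal.rpow_mul,
    one_div_mul_cancel hp.ne', ENNReal.rpow_one, ENNReal.rpow_one] at h2
  exact h2

/-- Moments of a predictable transform of the decoupled sequence that lives on the good sets. -/
lemma lintegral_transform_decoupled_le (hp : 0 < p) (hc : MidpointConst p c) (ha : 0 < a)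
    (hκ : IsSymmCondLaw μ 𝓕 (diffSeq f) κ) (hg : IsDecoupledSum μ 𝓕 f g)
    {V : ℕ → Set Ω} (hV : ∀ i, MeasurableSet[𝓕 i] (V i)) (hVG : ∀ i, V i ⊆ goodSet κ a ε i)
    {n : ℕ} {U : Set Ω} (hVU : ∀ i < n, V i ⊆ U) :
    ∫⁻ ω, ‖transform V (trunc a) g n ω‖ₑ ^ p ∂μ ≤
      c * (ENNReal.ofReal a ^ p * hjConst p ε) * μ U := by
  classical
  have hle : (⨆ k, 𝓕 k) ≤ mΩ := iSup_le 𝓕.le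
  have hem : ∀ n, 1 ≤ n → Measurable (diffSeq g n) := fun n hn =>
    (hg.2.stronglyMeasurable n hn).measurable
  let A : Finset ℕ → Set Ω := fun W => ⋂ i ∈ Finset.range n, {ω | ω ∈ V i ↔ i ∈ W}
  have hA : ∀ W, MeasurableSet[⨆ k, 𝓕 k] (A W) := fun W =>
    Finset.measurableSet_biInter _ fun k _ => by
      have hV' : MeasurableSet[⨆ k, 𝓕 k] (V k) := le_iSup 𝓕 k _ (hV k)
      by_cases hk : k ∈ W
      · simp only [hk, iff_true]; exact hV'
      · simp only [hk, iff_false]; exact hV'.compl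
  have hAmem : ∀ W ω, ω ∈ A W → ∀ i < n, (ω ∈ V i ↔ i ∈ W) := fun W ω hω i hi =>
    Set.mem_iInter₂.1 hω i (Finset.mem_range.2 hi)
  set M := c * (ENNReal.ofReal a ^ p * hjConst p ε) with hM
  let F : Finset ℕ → (ℕ → X) → ℝ≥0∞ := fun W x => ‖∑ i ∈ W, trunc a (x i)‖ₑ ^ p
  have htr := measurable_trunc (X := X) a
  have hF : ∀ W, Measurable (F W) := fun W => by dsimp only [F]; fun_prop
  have hFe : ∀ W, Measurable fun ω => F W fun i => diffSeq g (i + 1) ω := fun W =>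
    (hF W).comp (measurable_pi_lambda _ fun i => hem (i + 1) (by omega))
  have hpt : ∀ ω, ‖transform V (trunc a) g n ω‖ₑ ^ p ≤ ∑ W ∈ (Finset.range n).powerset,
      (A W).indicator (fun ω => F W fun i => diffSeq g (i + 1) ω) ω := by
    intro ω
    set W := (Finset.range n).filter fun i => ω ∈ V i with hW
    have hWA : ω ∈ A W := Set.mem_iInter₂.2 fun i hi => by
      simp only [Set.mem_ofPred_eq, hW, Finset.mem_filter]
      exact ⟨fun h => ⟨hi, h⟩, fun h => h.2⟩
    have hsum : transform V (trunc a) g n ω = ∑ i ∈ W, trunc a (diffSeq g (i + 1) ω) := by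
      rw [transform, hW, Finset.sum_filter]
      exact Finset.sum_congr rfl fun i _ => by simp only [Set.indicator_apply]
    have hle : ‖transform V (trunc a) g n ω‖ₑ ^ p ≤
        (A W).indicator (fun ω => F W fun i => diffSeq g (i + 1) ω) ω := by
      rw [Set.indicator_of_mem hWA, hsum]
    exact hle.trans (Finset.single_le_sum (f := fun W =>
      (A W).indicator (fun ω => F W fun i => diffSeq g (i + 1) ω) ω) (fun _ _ => zero_le)
      (Finset.mem_powerset.2 (Finset.filter_subset _ _ : W ⊆ Finset.range n)))
  have hterm : ∀ W ∈ (Finset.range n).powerset,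
      ∫⁻ ω in A W, F W (fun i => diffSeq g (i + 1) ω) ∂μ ≤ M * μ (A W ∩ U) := by
    intro W hWn
    rw [setLIntegral_decoupled hκ hg.2 hem (hA W) (hF W)]
    rcases W.eq_empty_or_nonempty with rfl | hne
    · simp [F, hp]
    · set m := W.max' hne with hm
      have hmW : m ∈ W := W.max'_mem hne
      have hmn : m < n := Finset.mem_range.1 (Finset.mem_powerset.1 hWn hmW)
      have hsub : A W ⊆ U := fun ω hω => hVU m hmn ((hAmem W ω hω m hmn).2 hmW)
      rw [Set.inter_eq_left.2 hsub]
      calc ∫⁻ ω in A W, ∫⁻ x, F W x ∂(Measure.infinitePi fun i => κ i ω) ∂μ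
          ≤ ∫⁻ _ω in A W, M ∂μ := by
            refine setLIntegral_mono' (hle _ (hA W)) fun ω hω => ?_
            refine lintegral_trunc_subsum_le (fun i => hκ.symm i ω) hp.le hc ha (m := m + 1)
              (hVG m ((hAmem W ω hω m hmn).2 hmW)) fun i hi => ?_
            exact Finset.mem_range.2 (Nat.lt_succ_of_le (W.le_max' i hi))
        _ = M * μ (A W) := by simp
  calc ∫⁻ ω, ‖transform V (trunc a) g n ω‖ₑ ^ p ∂μ
      ≤ ∫⁻ ω, ∑ W ∈ (Finset.range n).powerset,
          (A W).indicator (fun ω => F W fun i => diffSeq g (i + 1) ω) ω ∂μ := lintegral_mono hpt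
    _ = ∑ W ∈ (Finset.range n).powerset,
          ∫⁻ ω in A W, F W (fun i => diffSeq g (i + 1) ω) ∂μ := by
        rw [lintegral_finsetSum _ fun W _ => (hFe W).indicator (hle _ (hA W))]
        exact Finset.sum_congr rfl fun W _ => lintegral_indicator (hle _ (hA W)) _
    _ ≤ ∑ W ∈ (Finset.range n).powerset, M * μ (A W ∩ U) := Finset.sum_le_sum hterm
    _ ≤ M * μ U := by
        rw [← Finset.mul_sum]
        refine mul_le_mul_right ?_ M
        have hr : ∀ W, μ (A W ∩ U) = (μ.restrict U) (A W) := fun W =>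
          (Measure.restrict_apply (hle _ (hA W))).symm
        simp only [hr]
        rw [← measure_biUnion_finset]
        · exact (measure_mono (Set.subset_univ _)).trans_eq (by simp)
        · intro W hW W' hW' hne
          rw [Function.onFun, Set.disjoint_left]
          intro ω h h'
          refine hne (Finset.ext fun i => ?_)
          by_cases hi : i < n
          · rw [← hAmem W ω h i hi, hAmem W' ω h' i hi]
          · have h1 : i ∉ W := fun hc => hi (Finset.mem_range.1
              (Finset.mem_powerset.1 (Finset.mem_coe.1 hW) hc))
            have h2 : i ∉ W' := fun hc => hi (Finset.mem_range.1
              (Finset.mem_powerset.1 (Finset.mem_coe.1 hW') hc))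
            simp [h1, h2]
        · exact fun W _ => hle _ (hA W)

lemma goodLambda_step (hX : DecouplingWith.{u, v} X p D) (hp : 0 < p) (hc : MidpointConst p c)
    [μ.IsComplete] (h0 : 𝓕 0 = ⊥) (hf : ∀ n, 1 ≤ n → Measurable[𝓕 n] (diffSeq f n))
    (hκ : IsSymmCondLaw μ 𝓕 (diffSeq f) κ) (hg : IsDecoupledSum μ 𝓕 f g)
    (ha : 0 < a) {s h : ℝ} (hs : 0 ≤ s) (hh : 0 < h) {n : ℕ} (hn : 1 ≤ n) :
    ENNReal.ofReal h ^ p *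
        μ {ω | ∃ j ≤ n, s + a + h < ‖transform (goodSet κ a ε) (trunc a) f j ω‖} ≤
      (D : ℝ≥0∞) ^ p * (c * (ENNReal.ofReal a ^ p * hjConst p ε) *
        μ {ω | ∃ j ≤ n, s < ‖transform (goodSet κ a ε) (trunc a) f j ω‖}) := by
  have htr := measurable_trunc (X := X) a
  have hd' : ∀ n, 1 ≤ n → Measurable (diffSeq f n) := fun n hn => (hf n hn).mono (𝓕.le n) le_rfl
  set G := goodSet κ a ε with hG
  have hGm : ∀ i, MeasurableSet[𝓕 i] (G i) := measurableSet_goodSet hκ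
  set U : ℕ → Set Ω := fun i => {ω | ∃ j ≤ i, s < ‖transform G (trunc a) f j ω‖} with hU
  have hUm : ∀ i, MeasurableSet[𝓕 i] (U i) := fun i =>
    measurableSet_exists_lt_transform hGm htr hf i s
  have hGU : ∀ i, MeasurableSet[𝓕 i] (G i ∩ U i) := fun i => (hGm i).inter (hUm i)
  set V : ℕ → Set Ω := fun i => G i ∩ U i ∩
    {ω | ∀ l ≤ i, ‖transform (fun i => G i ∩ U i) (trunc a) f l ω‖ ≤ h} with hV
  have hVm : ∀ i, MeasurableSet[𝓕 i] (V i) := fun i => by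
    refine (hGU i).inter ?_
    have : {ω | ∀ l ≤ i, ‖transform (fun i => G i ∩ U i) (trunc a) f l ω‖ ≤ h} =
        {ω | ∃ l ≤ i, h < ‖transform (fun i => G i ∩ U i) (trunc a) f l ω‖}ᶜ := by
      ext ω; simp
    rw [this]
    exact (measurableSet_exists_lt_transform hGU htr hf i h).compl
  have hadapt := measurable_transform (f := f) hVm htr hf
  have hmeas : Measurable fun ω => ‖transform V (trunc a) f n ω‖ₑ ^ p := by
    have := (hadapt n).mono (𝓕.le n) le_rfl
    fun_prop
  calc ENNReal.ofReal h ^ p * μ {ω | ∃ j ≤ n, s + a + h < ‖transform G (trunc a) f j ω‖}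
      ≤ ENNReal.ofReal h ^ p *
          μ {ω | ENNReal.ofReal h ^ p ≤ ‖transform V (trunc a) f n ω‖ₑ ^ p} := by
        refine mul_le_mul_right (measure_mono fun ω hω => ?_) _
        have := exists_lt_norm_stopped ha.le hs hh hω
        refine ENNReal.rpow_le_rpow ?_ hp.le
        rw [← ofReal_norm]
        exact ENNReal.ofReal_le_ofReal this.le
    _ ≤ ∫⁻ ω, ‖transform V (trunc a) f n ω‖ₑ ^ p ∂μ := mul_meas_ge_le_lintegral hmeas _
    _ ≤ (D : ℝ≥0∞) ^ p * ∫⁻ ω, ‖transform V (trunc a) g n ω‖ₑ ^ p ∂μ := by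
        refine lintegral_le_of_decouplingWith hX hp h0 (by ext ω; simp [transform])
          (fun j => (hadapt j).stronglyMeasurable) (fun j => ?_) (hg.transform hd' hVm htr) hn
        refine MemLp.of_bound ((hadapt j).mono (𝓕.le j) le_rfl).aestronglyMeasurable (j * a)
          (ae_of_all _ fun ω => norm_transform_trunc_le ha.le j)
    _ ≤ _ := by
        refine mul_le_mul_right ?_ _
        refine lintegral_transform_decoupled_le hp hc ha hκ hg hVm (fun i ω hω => hω.1.1)
          fun i hi ω hω => ?_
        obtain ⟨j, hj, hlt⟩ := hω.1.2
        exact ⟨j, hj.trans hi.le, hlt⟩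

/-- The event on which the truncated and stopped sequence may differ from `f`. -/
lemma measure_bad_le (hf : ∀ n, 1 ≤ n → Measurable[𝓕 n] (diffSeq f n))
    (hκ : IsSymmCondLaw μ 𝓕 (diffSeq f) κ) (hg : IsDecoupledSum μ 𝓕 f g)
    (hε : ε ≠ 0) (hε' : ε ≠ ⊤) (n : ℕ) :
    μ {ω | (∃ i < n, a < ‖diffSeq f (i + 1) ω‖) ∨ ∃ i < n, ω ∉ goodSet κ a ε i} ≤
      4 * (1 + ε⁻¹) * μ {ω | a < ‖g n ω‖} := by
  have hem : ∀ n, 1 ≤ n → Measurable (diffSeq g n) := fun n hn =>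
    (hg.2.stronglyMeasurable n hn).measurable
  have hSm : MeasurableSet {x : ℕ → X | a < ‖∑ i ∈ Finset.range n, x i‖} :=
    measurableSet_lt_norm_sum (φ := id) measurable_id _ _
  have hgn : μ {ω | a < ‖g n ω‖} = ∫⁻ ω, Measure.infinitePi (fun i => κ i ω)
      {x : ℕ → X | a < ‖∑ i ∈ Finset.range n, x i‖} ∂μ := by
    rw [← measure_decoupled hκ hg.2 hem hSm]
    congr 1
    ext ω
    simp only [Set.mem_ofPred_eq]
    rw [eq_sum_diffSeq hg.1]
  have h1 : μ {ω | ∃ i < n, a < ‖diffSeq f (i + 1) ω‖} ≤ 4 * μ {ω | a < ‖g n ω‖} := by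
    refine (hκ.measure_max_le hf n a).trans ?_
    rw [hgn, ← lintegral_const_mul' _ _ (by norm_num), ← lintegral_const_mul' _ _ (by norm_num)]
    refine lintegral_mono fun ω => ?_
    refine (mul_le_mul_right (levy_term (fun i => hκ.symm i ω) n a) 2).trans_eq ?_
    rw [← mul_assoc]; norm_num
  have hκm : ∀ i B, MeasurableSet B → Measurable fun ω => κ i ω B := fun i B hB =>
    (hκ.meas i B hB).mono (𝓕.le i) le_rfl
  have hQm : Measurable fun ω => Measure.infinitePi (fun i => κ i ω) (exceed (trunc a) n a) :=
    (Measure.measurable_coe (measurableSet_exceed (measurable_trunc a) n a)).comp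
      (measurable_infinitePi hκm)
  have h2 : μ {ω | ∃ i < n, ω ∉ goodSet κ a ε i} ≤ 4 * ε⁻¹ * μ {ω | a < ‖g n ω‖} := by
    have hM := mul_meas_ge_le_lintegral (μ := μ) hQm ε
    have hb : ∫⁻ ω, Measure.infinitePi (fun i => κ i ω) (exceed (trunc a) n a) ∂μ ≤
        4 * μ {ω | a < ‖g n ω‖} := by
      rw [hgn, ← lintegral_const_mul' _ _ (by norm_num)]
      refine lintegral_mono fun ω => ?_
      refine (measure_exceed_trunc_le (fun i => hκ.symm i ω) n a a).trans ?_
      refine (mul_le_mul_right (levy_sum (fun i => hκ.symm i ω) measurable_id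
        (fun x => rfl) n a) 2).trans_eq ?_
      rw [← mul_assoc]; norm_num
    calc μ {ω | ∃ i < n, ω ∉ goodSet κ a ε i}
        ≤ μ {ω | ε ≤ Measure.infinitePi (fun i => κ i ω) (exceed (trunc a) n a)} := by
          refine measure_mono ?_
          rintro ω ⟨i, hi, hω⟩
          refine (not_le.1 hω).le.trans (measure_mono ?_)
          rintro x ⟨j, hj, hx⟩
          exact ⟨j, hj.trans hi, hx⟩
      _ = ε⁻¹ * (ε * μ {ω | ε ≤ Measure.infinitePi (fun i => κ i ω)
            (exceed (trunc a) n a)}) := by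
          rw [← mul_assoc, ENNReal.inv_mul_cancel hε hε', one_mul]
      _ ≤ ε⁻¹ * (4 * μ {ω | a < ‖g n ω‖}) := mul_le_mul_right (hM.trans hb) _
      _ = _ := by ring
  calc _ ≤ _ := measure_union_le _ _
    _ ≤ _ := add_le_add h1 h2
    _ = _ := by ring

/-- The good-`λ` inequality. -/
lemma goodLambda (hX : DecouplingWith.{u, v} X p D) (hp : 0 < p) (hc : MidpointConst p c)
    [μ.IsComplete] (h0 : 𝓕 0 = ⊥) (hf0 : f 0 = 0)
    (hf : ∀ n, 1 ≤ n → Measurable[𝓕 n] (diffSeq f n))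
    (hκ : IsSymmCondLaw μ 𝓕 (diffSeq f) κ) (hg : IsDecoupledSum μ 𝓕 f g)
    (hε : ε ≠ 0) (hε' : ε ≠ ⊤) (ha : 0 < a) {H : ℝ} (hH : 0 < H) {r : ℝ≥0∞}
    (hr : (D : ℝ≥0∞) ^ p * (c * hjConst p ε) ≤ r * ENNReal.ofReal H ^ p)
    {n : ℕ} (hn : 1 ≤ n) (k : ℕ) {s : ℝ} (hs : 0 ≤ s) :
    μ {ω | ∃ j ≤ n, s + k * (a + H * a) < ‖f j ω‖} ≤
      r ^ k * μ {ω | ∃ j ≤ n, s < ‖f j ω‖} +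
        (1 + r ^ k) * (4 * (1 + ε⁻¹)) * μ {ω | a < ‖g n ω‖} := by
  have hstep : ∀ s : ℝ, 0 ≤ s →
      μ {ω | ∃ j ≤ n, s + (a + H * a) < ‖transform (goodSet κ a ε) (trunc a) f j ω‖} ≤
        r * μ {ω | ∃ j ≤ n, s < ‖transform (goodSet κ a ε) (trunc a) f j ω‖} := by
    intro s hs
    have hHa : 0 < H * a := mul_pos hH ha
    have h := goodLambda_step (ε := ε) hX hp hc h0 hf hκ hg ha hs hHa hn
    have hne : ENNReal.ofReal (H * a) ^ p ≠ 0 := by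
      simp only [ne_eq, ENNReal.rpow_eq_zero_iff, not_or, not_and, ENNReal.ofReal_eq_zero]
      exact ⟨fun h => absurd h (not_le.2 hHa), fun h => absurd h ENNReal.ofReal_ne_top⟩
    have hnt : ENNReal.ofReal (H * a) ^ p ≠ ⊤ :=
      ENNReal.rpow_ne_top_of_nonneg hp.le ENNReal.ofReal_ne_top
    refine (ENNReal.mul_le_mul_iff_right hne hnt).1 ?_
    rw [← add_assoc s]
    refine h.trans ?_
    rw [ENNReal.ofReal_mul hH.le, ENNReal.mul_rpow_of_nonneg _ _ hp.le]
    set m := μ {ω | ∃ j ≤ n, s < ‖transform (goodSet κ a ε) (trunc a) f j ω‖}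
    calc (D : ℝ≥0∞) ^ p * (c * (ENNReal.ofReal a ^ p * hjConst p ε) * m)
        = (D : ℝ≥0∞) ^ p * (c * hjConst p ε) * (ENNReal.ofReal a ^ p * m) := by ring
      _ ≤ r * ENNReal.ofReal H ^ p * (ENNReal.ofReal a ^ p * m) := by gcongr
      _ = _ := by ring
  have hiter : ∀ k : ℕ,
      μ {ω | ∃ j ≤ n, s + k * (a + H * a) < ‖transform (goodSet κ a ε) (trunc a) f j ω‖} ≤
        r ^ k * μ {ω | ∃ j ≤ n, s < ‖transform (goodSet κ a ε) (trunc a) f j ω‖} := by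
    intro k
    induction k with
    | zero => simp
    | succ k ih =>
      have hs' : 0 ≤ s + k * (a + H * a) := by positivity
      have heq : s + ((k + 1 : ℕ) : ℝ) * (a + H * a) =
          s + k * (a + H * a) + (a + H * a) := by push_cast; ring
      rw [heq]
      refine (hstep _ hs').trans ((mul_le_mul_right ih r).trans_eq ?_)
      ring
  set Bad : Set Ω := {ω | (∃ i < n, a < ‖diffSeq f (i + 1) ω‖) ∨ ∃ i < n, ω ∉ goodSet κ a ε i}
    with hBad
  have hgood : ∀ ω, ω ∉ Bad → ∀ j ≤ n, transform (goodSet κ a ε) (trunc a) f j ω = f j ω := by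
    intro ω hω j hj
    simp only [hBad, Set.mem_ofPred_eq, not_or, not_exists, not_and, not_lt, not_not] at hω
    exact transform_trunc_eq hf0 hj hω.2 hω.1
  have hb := measure_bad_le (a := a) hf hκ hg hε hε' n
  calc μ {ω | ∃ j ≤ n, s + k * (a + H * a) < ‖f j ω‖}
      ≤ μ ({ω | ∃ j ≤ n, s + k * (a + H * a) <
          ‖transform (goodSet κ a ε) (trunc a) f j ω‖} ∪ Bad) := by
        refine measure_mono ?_
        rintro ω ⟨j, hj, h⟩
        by_cases hω : ω ∈ Bad
        · exact Or.inr hω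
        · exact Or.inl ⟨j, hj, by rwa [hgood ω hω j hj]⟩
    _ ≤ r ^ k * μ {ω | ∃ j ≤ n, s < ‖transform (goodSet κ a ε) (trunc a) f j ω‖} + μ Bad :=
        (measure_union_le _ _).trans (add_le_add (hiter k) le_rfl)
    _ ≤ r ^ k * (μ {ω | ∃ j ≤ n, s < ‖f j ω‖} + μ Bad) + μ Bad := by
        gcongr
        refine (measure_mono ?_).trans (measure_union_le _ _)
        rintro ω ⟨j, hj, h⟩
        by_cases hω : ω ∈ Bad
        · exact Or.inr hω
        · exact Or.inl ⟨j, hj, by rwa [← hgood ω hω j hj]⟩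
    _ = r ^ k * μ {ω | ∃ j ≤ n, s < ‖f j ω‖} + (1 + r ^ k) * μ Bad := by ring
    _ ≤ _ := by
        rw [mul_assoc (1 + r ^ k)]
        gcongr

end GoodLambda

section PhiMoments

lemma exists_lt_iff_of_continuous {Φ : ℝ≥0 → ℝ≥0} (hmono : Monotone Φ) (hcont : Continuous Φ)
    (h0 : Φ 0 = 0) {t : ℝ} (ht : 0 < t) :
    (∀ y, ¬ t < Φ y) ∨ ∃ s : ℝ≥0, 0 < s ∧ ∀ y, t < Φ y ↔ s < y := by
  by_cases hb : BddAbove {y | (Φ y : ℝ) ≤ t}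
  · right
    have hcl : IsClosed {y | (Φ y : ℝ) ≤ t} :=
      isClosed_le (NNReal.continuous_coe.comp hcont) continuous_const
    have hmem : sSup {y | (Φ y : ℝ) ≤ t} ∈ {y | (Φ y : ℝ) ≤ t} :=
      hcl.csSup_mem ⟨0, by simp [h0, ht.le]⟩ hb
    refine ⟨sSup {y | (Φ y : ℝ) ≤ t}, ?_, fun y => ⟨fun h => ?_, fun h => ?_⟩⟩
    · have hn : {y | (Φ y : ℝ) < t} ∈ nhds (0 : ℝ≥0) :=
        (isOpen_lt (NNReal.continuous_coe.comp hcont) continuous_const).mem_nhds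
          (by simpa [h0] using ht)
      obtain ⟨y, hy, hy0⟩ := Filter.nonempty_of_mem
        (Filter.inter_mem (mem_nhdsWithin_of_mem_nhds hn) (self_mem_nhdsWithin (s := Set.Ioi 0)))
      have hyt : (Φ y : ℝ) < t := hy
      exact lt_of_lt_of_le hy0 (le_csSup hb (a := y) hyt.le)
    · by_contra hc
      have h1 : (Φ y : ℝ) ≤ Φ (sSup {y | (Φ y : ℝ) ≤ t}) :=
        NNReal.coe_le_coe.2 (hmono (not_lt.1 hc))
      exact absurd h (not_lt.2 (h1.trans hmem))
    · by_contra hc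
      exact absurd h (not_lt.2 (le_csSup hb (not_lt.1 hc)))
  · left
    intro y hy
    refine hb ⟨y, fun z hz => ?_⟩
    by_contra hc
    have h1 : (Φ y : ℝ) ≤ Φ z := NNReal.coe_le_coe.2 (hmono (not_le.1 hc).le)
    exact absurd hy (not_lt.2 (h1.trans hz))

variable {Ω : Type u} [MeasurableSpace Ω] {μ : Measure Ω}

lemma lintegral_comp_eq_lintegral_meas_lt {Φ : ℝ≥0 → ℝ≥0} (hcont : Continuous Φ) {Y : Ω → ℝ≥0}
    (hY : Measurable Y) :
    ∫⁻ ω, (Φ (Y ω) : ℝ≥0∞) ∂μ = ∫⁻ t in Set.Ioi (0 : ℝ), μ {ω | t < Φ (Y ω)} := by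
  rw [← lintegral_eq_lintegral_meas_lt μ (f := fun ω => (Φ (Y ω) : ℝ))
    (ae_of_all _ fun ω => NNReal.coe_nonneg _)
    (hcont.measurable.comp hY).coe_nnreal_real.aemeasurable]
  simp

/-- Tail estimates transfer to `Φ`-moments. -/
lemma lintegral_comp_le_of_tail {Φ : ℝ≥0 → ℝ≥0} (hmono : Monotone Φ) (hcont : Continuous Φ)
    (h0 : Φ 0 = 0) {Y Z W : Ω → ℝ≥0} (hY : Measurable Y) (hZ : Measurable Z) (hW : Measurable W)
    {r K : ℝ≥0∞}
    (h : ∀ s : ℝ≥0, 0 < s → μ {ω | s < Y ω} ≤ r * μ {ω | s < Z ω} + K * μ {ω | s < W ω}) :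
    ∫⁻ ω, (Φ (Y ω) : ℝ≥0∞) ∂μ ≤
      r * ∫⁻ ω, (Φ (Z ω) : ℝ≥0∞) ∂μ + K * ∫⁻ ω, (Φ (W ω) : ℝ≥0∞) ∂μ := by
  have hm : ∀ T : Ω → ℝ≥0, Measurable fun t : ℝ => μ {ω | t < Φ (T ω)} := fun T =>
    Antitone.measurable fun s t hst => measure_mono fun ω hω => lt_of_le_of_lt hst hω
  rw [lintegral_comp_eq_lintegral_meas_lt hcont hY, lintegral_comp_eq_lintegral_meas_lt hcont hZ,
    lintegral_comp_eq_lintegral_meas_lt hcont hW, ← lintegral_const_mul _ (hm Z),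
    ← lintegral_const_mul _ (hm W), ← lintegral_add_left ((hm Z).const_mul r)]
  refine setLIntegral_mono' measurableSet_Ioi fun t ht => ?_
  rcases exists_lt_iff_of_continuous hmono hcont h0 ht with hno | ⟨s, hs, hiff⟩
  · simp [hno]
  · simpa only [hiff] using h s hs

lemma le_div_of_le_mul_add {I ρ T : ℝ≥0∞} (hI : I ≠ ⊤) (hρ : ρ < 1) (h : I ≤ ρ * I + T) :
    I ≤ T / (1 - ρ) := by
  have h1 : (1 - ρ) * I ≤ T := by
    rw [ENNReal.sub_mul fun _ _ => hI, one_mul]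
    exact tsub_le_iff_left.2 h
  rw [ENNReal.le_div_iff_mul_le (Or.inl (tsub_pos_of_lt hρ).ne')
    (Or.inl (ne_top_of_le_ne_top ENNReal.one_ne_top tsub_le_self)), mul_comm]
  exact h1

/-- Absorption of the left-hand side of a good-`λ` inequality. -/
lemma lintegral_comp_le_of_goodLambda [IsProbabilityMeasure μ] {q : ℝ} (hq : 0 < q)
    {Φ : ℝ≥0 → ℝ≥0} (hΦ : GrowthClass q Φ) {F G : Ω → ℝ≥0} (hF : Measurable F)
    (hG : Measurable G) {r K : ℝ≥0∞} {L : ℝ≥0} (hL : 1 ≤ L) (hr : 2 ^ q * r < 1)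
    (h : ∀ s : ℝ≥0, 0 < s →
      μ {ω | 2 * s < F ω} ≤ r * μ {ω | s < F ω} + K * μ {ω | s < L * G ω}) :
    ∫⁻ ω, (Φ (F ω) : ℝ≥0∞) ∂μ ≤
      2 ^ q * K * (L : ℝ≥0∞) ^ q / (1 - 2 ^ q * r) * ∫⁻ ω, (Φ (G ω) : ℝ≥0∞) ∂μ := by
  set J := ∫⁻ ω, (Φ (G ω) : ℝ≥0∞) ∂μ with hJ
  have hbound : ∀ N : ℕ, ∫⁻ ω, ((min (Φ (F ω)) N : ℝ≥0) : ℝ≥0∞) ∂μ ≤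
      2 ^ q * K * (L : ℝ≥0∞) ^ q / (1 - 2 ^ q * r) * J := by
    intro N
    set Ψ : ℝ≥0 → ℝ≥0 := fun t => min (Φ t) N with hΨ
    have hΨmono : Monotone Ψ := fun s t hst => min_le_min_right _ (hΦ.mono hst)
    have hΨcont : Continuous Ψ := hΦ.cont.min continuous_const
    have hgrow : ∀ s t : ℝ≥0, 1 ≤ s → Ψ (s * t) ≤ s ^ q * Ψ t := fun s t hs => by
      have h1 : (1 : ℝ≥0) ≤ s ^ q := NNReal.one_le_rpow hs hq.le
      refine (min_le_min (hΦ.growth s t hs) (le_mul_of_one_le_left zero_le h1)).trans_eq ?_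
      exact (mul_min _ _ _).symm
    have hgrow' : ∀ s t : ℝ≥0, 1 ≤ s → (Ψ (s * t) : ℝ≥0∞) ≤ (s : ℝ≥0∞) ^ q * Ψ t := fun s t hs => by
      rw [← ENNReal.coe_rpow_of_nonneg _ hq.le, ← ENNReal.coe_mul]
      exact ENNReal.coe_le_coe.2 (hgrow s t hs)
    set I := ∫⁻ ω, (Ψ (F ω) : ℝ≥0∞) ∂μ with hI
    have hItop : I ≠ ⊤ := by
      refine ne_top_of_le_ne_top (b := ∫⁻ _ω, (N : ℝ≥0∞) ∂μ) (by simp) (lintegral_mono fun ω => ?_)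
      have : Ψ (F ω) ≤ (N : ℝ≥0) := min_le_right _ _
      exact (ENNReal.coe_le_coe.2 this).trans_eq (by simp)
    have htail := lintegral_comp_le_of_tail (μ := μ) hΨmono hΨcont (by simp [hΨ, hΦ.zero])
      (Y := fun ω => F ω / 2) (Z := F) (W := fun ω => L * G ω) (by fun_prop) hF (by fun_prop)
      (r := r) (K := K) (fun s hs => by
        have : {ω | s < F ω / 2} = {ω | 2 * s < F ω} := by
          ext ω
          simp only [Set.mem_ofPred_eq]
          rw [lt_div_iff₀ (by norm_num), mul_comm]
        rw [this]
        exact h s hs)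
    have h1 : I ≤ 2 ^ q * ∫⁻ ω, (Ψ (F ω / 2) : ℝ≥0∞) ∂μ := by
      rw [← lintegral_const_mul' _ _ (ENNReal.rpow_ne_top_of_nonneg hq.le (by norm_num))]
      refine lintegral_mono fun ω => ?_
      have := hgrow' 2 (F ω / 2) (by norm_num)
      rwa [mul_div_cancel₀ _ (by norm_num)] at this
    have h2 : ∫⁻ ω, (Ψ (L * G ω) : ℝ≥0∞) ∂μ ≤ (L : ℝ≥0∞) ^ q * J := by
      rw [hJ, ← lintegral_const_mul' _ _
        (ENNReal.rpow_ne_top_of_nonneg hq.le ENNReal.coe_ne_top)]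
      refine lintegral_mono fun ω => (hgrow' L (G ω) hL).trans ?_
      refine mul_le_mul_right ?_ _
      exact_mod_cast min_le_left (Φ (G ω)) (N : ℝ≥0)
    have h3 : I ≤ 2 ^ q * r * I + 2 ^ q * K * (L : ℝ≥0∞) ^ q * J :=
      calc I ≤ 2 ^ q * (r * I + K * ((L : ℝ≥0∞) ^ q * J)) :=
            h1.trans (mul_le_mul_right (htail.trans
              (add_le_add le_rfl (mul_le_mul_right h2 K))) _)
        _ = _ := by ring
    refine (le_div_of_le_mul_add hItop hr h3).trans_eq ?_
    rw [ENNReal.mul_div_right_comm]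
  have hsup : ∀ ω, (Φ (F ω) : ℝ≥0∞) = ⨆ N : ℕ, ((min (Φ (F ω)) N : ℝ≥0) : ℝ≥0∞) := by
    intro ω
    refine le_antisymm ?_ (iSup_le fun N => by exact_mod_cast min_le_left _ _)
    obtain ⟨N, hN⟩ := exists_nat_ge (Φ (F ω))
    refine le_iSup_of_le N ?_
    rw [min_eq_left hN]
  simp only [hsup]
  rw [lintegral_iSup]
  · exact iSup_le hbound
  · intro N
    exact ((hΦ.cont.measurable.comp hF).min measurable_const).coe_nnreal_ennreal
  · intro N M hNM ω
    have : min (Φ (F ω)) (N : ℝ≥0) ≤ min (Φ (F ω)) M := min_le_min_left _ (by exact_mod_cast hNM)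
    exact ENNReal.coe_le_coe.2 this

end PhiMoments

section Separable

variable {Ω : Type u} {X : Type v} [mΩ : MeasurableSpace Ω] [NormedAddCommGroup X]
  [NormedSpace ℝ X] [MeasurableSpace X] [BorelSpace X]
  {μ : Measure Ω} [IsProbabilityMeasure μ] {𝓕 : Filtration ℕ mΩ} {f g : ℕ → Ω → X}
  {p : ℝ} {D : ℝ≥0} {c ε : ℝ≥0∞}

omit mΩ [NormedSpace ℝ X] [MeasurableSpace X] [BorelSpace X] in
lemma lt_maxFun_iff (h0 : f 0 = 0) (n : ℕ) (s : ℝ≥0) (ω : Ω) :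
    s < maxFun f n ω ↔ ∃ j ≤ n, (s : ℝ) < ‖f j ω‖ := by
  rw [maxFun, Finset.lt_sup_iff]
  constructor
  · rintro ⟨j, hj, h⟩
    exact ⟨j, (Finset.mem_Icc.1 hj).2, h⟩
  · rintro ⟨j, hj, h⟩
    refine ⟨j, Finset.mem_Icc.2 ⟨?_, hj⟩, h⟩
    by_contra hc
    obtain rfl : j = 0 := by omega
    simp only [h0, Pi.zero_apply, norm_zero] at h
    exact absurd h (not_lt.2 s.coe_nonneg)

lemma lintegral_maxFun_le_of_separable [SecondCountableTopology X] [CompleteSpace X]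
    (hX : DecouplingWith.{u, v} X p D) (hp : 0 < p) (hc : MidpointConst p c)
    [μ.IsComplete] (h0 : 𝓕 0 = ⊥) (hf0 : f 0 = 0) (hf : StronglyAdapted 𝓕 f)
    (hsymm : ∀ n, 1 ≤ n → CondSymmetric μ (𝓕 (n - 1)) (diffSeq f n))
    (hg : IsDecoupledSum μ 𝓕 f g) (hε : ε ≠ 0) (hε' : ε ≠ ⊤) {H : ℝ≥0} (hH : 0 < H) {r : ℝ≥0∞}
    (hr : (D : ℝ≥0∞) ^ p * (c * hjConst p ε) ≤ r * (H : ℝ≥0∞) ^ p) {k : ℕ} (hk : 1 ≤ k)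
    {q : ℝ} (hq : 0 < q) (hrk : 2 ^ q * r ^ k < 1) {Φ : ℝ≥0 → ℝ≥0} (hΦ : GrowthClass q Φ)
    {n : ℕ} (hn : 1 ≤ n) :
    ∫⁻ ω, (Φ (maxFun f n ω) : ℝ≥0∞) ∂μ ≤
      2 ^ q * ((1 + r ^ k) * (4 * (1 + ε⁻¹))) * ((k * (1 + H) : ℝ≥0) : ℝ≥0∞) ^ q /
        (1 - 2 ^ q * r ^ k) * ∫⁻ ω, (Φ ‖g n ω‖₊ : ℝ≥0∞) ∂μ := by
  have hfm : ∀ n, Measurable[𝓕 n] (f n) := fun n => (hf n).measurable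
  have hd : ∀ n, 1 ≤ n → Measurable[𝓕 n] (diffSeq f n) := fun n _ =>
    (hfm n).sub ((hfm (n - 1)).mono (𝓕.mono (Nat.sub_le n 1)) le_rfl)
  obtain ⟨κ, hκ1, hκ⟩ := exists_isSymmCondLaw
    (fun n hn => (hd n hn).mono (𝓕.le n) le_rfl) hsymm
  have hgm : Measurable (g n) := by
    have : g n = fun ω => ∑ i ∈ Finset.range n, diffSeq g (i + 1) ω := by
      ext ω; exact eq_sum_diffSeq hg.1 n ω
    rw [this]
    exact Finset.measurable_fun_sum _ fun i _ =>
      (hg.2.stronglyMeasurable (i + 1) (by omega)).measurable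
  have hFm : Measurable (maxFun f n) := by
    refine measurable_of_Ioi fun s => ?_
    have : maxFun f n ⁻¹' Set.Ioi s =
        ⋃ j ∈ Finset.range (n + 1), {ω | (s : ℝ) < ‖f j ω‖} := by
      ext ω; simp [lt_maxFun_iff hf0]
    rw [this]
    exact Finset.measurableSet_biUnion _ fun j _ =>
      (hfm j).mono (𝓕.le j) le_rfl (measurableSet_lt measurable_const measurable_norm)
  have hk' : (1 : ℝ≥0) ≤ k := by exact_mod_cast hk
  have hL : 1 ≤ k * (1 + H) := one_le_mul hk' le_self_add
  refine lintegral_comp_le_of_goodLambda hq hΦ hFm hgm.nnnorm hL hrk fun s hs => ?_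
  have hLpos : (0 : ℝ) < k * (1 + H) := by
    have : (0 : ℝ≥0) < k * (1 + H) := lt_of_lt_of_le one_pos hL
    exact_mod_cast this
  have hs' : (0 : ℝ) < s := hs
  have hgl := goodLambda (a := s / (k * (1 + H))) (H := H) (r := r) hX hp hc h0 hf0 hd hκ hg hε hε'
    (div_pos hs' hLpos) (by exact_mod_cast hH) (by rwa [ENNReal.ofReal_coe_nnreal]) hn k hs'.le
  have h2s : (s : ℝ) + k * (s / (k * (1 + H)) + H * (s / (k * (1 + H)))) = ((2 * s : ℝ≥0) : ℝ) := by
    push_cast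
    have : (k : ℝ) * (s / (k * (1 + H)) + H * (s / (k * (1 + H)))) =
      (k * (1 + H)) * (s / (k * (1 + H))) := by ring
    rw [this, mul_div_cancel₀ _ hLpos.ne']
    ring
  rw [h2s] at hgl
  simp only [lt_maxFun_iff hf0]
  have hset : {ω | (s : ℝ) / (k * (1 + H)) < ‖g n ω‖} = {ω | s < k * (1 + H) * ‖g n ω‖₊} := by
    ext ω
    simp only [Set.mem_ofPred_eq]
    rw [div_lt_iff₀' hLpos, ← NNReal.coe_lt_coe]
    push_cast
    rfl
  rwa [hset] at hgl

end Separable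

section Constants

lemma one_add_two_mul_rpow_le {p : ℝ} (hp : 1 ≤ p) :
    1 + 2 * (5 / 3 : ℝ) ^ p ≤ 13 / 6 * 2 ^ p := by
  have h1 : (1 / 2 : ℝ) ^ p ≤ 1 / 2 :=
    (Real.rpow_le_rpow_of_exponent_ge (by norm_num) (by norm_num) hp).trans_eq (Real.rpow_one _)
  have h2 : (5 / 6 : ℝ) ^ p ≤ 5 / 6 :=
    (Real.rpow_le_rpow_of_exponent_ge (by norm_num) (by norm_num) hp).trans_eq (Real.rpow_one _)
  have e1 : (1 / 2 : ℝ) ^ p * 2 ^ p = 1 := by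
    rw [← Real.mul_rpow (by norm_num) (by norm_num)]; norm_num
  have e2 : (5 / 6 : ℝ) ^ p * 2 ^ p = (5 / 3) ^ p := by
    rw [← Real.mul_rpow (by norm_num) (by norm_num)]; norm_num
  have h3 : (0 : ℝ) < 2 ^ p := by positivity
  nlinarith

lemma one_add_two_mul_rpow_le' {p : ℝ} (hp : 1 ≤ p) :
    1 + 2 * (5 / 3 : ℝ) ^ p ≤ 13 / 5 * (5 / 3) ^ p := by
  have : (5 / 3 : ℝ) ≤ (5 / 3) ^ p :=
    (Real.rpow_one _).symm.trans_le (Real.rpow_le_rpow_of_exponent_le (by norm_num) hp)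
  linarith

lemma exp_one_ge : (8 / 3 : ℝ) ≤ Real.exp 1 := by
  linarith [Real.exp_one_gt_d9]

/-- `y ^ y ≥ e ^ (-1/e)`, in the form needed for the constant. -/
lemma rpow_ge_of_small {p q : ℝ} (hp : 0 < p) (hq : 0 < q) :
    (55 / 64 : ℝ) ^ p ≤ (8 / 3 * (q / p)) ^ q := by
  set y := 8 / 3 * (q / p) with hy
  have hy0 : 0 < y := by positivity
  have hq' : q = 3 / 8 * p * y := by rw [hy]; field_simp
  have hlog : -(3 / 8) ≤ y * Real.log y := by
    have h1 := Real.log_le_sub_one_of_pos (x := 1 / (Real.exp 1 * y)) (by positivity)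
    rw [one_div, Real.log_inv, Real.log_mul (Real.exp_ne_zero _) hy0.ne', Real.log_exp] at h1
    have h2 : y * (Real.exp 1 * y)⁻¹ = (Real.exp 1)⁻¹ := by
      have := Real.exp_ne_zero 1
      field_simp
    have h3 : (Real.exp 1)⁻¹ ≤ 3 / 8 := by
      rw [inv_le_comm₀ (Real.exp_pos 1) (by norm_num)]
      linarith [exp_one_ge]
    nlinarith [mul_le_mul_of_nonneg_left h1 hy0.le]
  have hbase : (55 / 64 : ℝ) ≤ Real.exp (-(9 / 64)) := by
    linarith [Real.add_one_le_exp (-(9 / 64) : ℝ)]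
  calc (55 / 64 : ℝ) ^ p ≤ Real.exp (-(9 / 64)) ^ p :=
        Real.rpow_le_rpow (by norm_num) hbase hp.le
    _ = Real.exp (-(9 / 64) * p) := by rw [← Real.exp_mul]
    _ ≤ Real.exp (Real.log y * q) := by
        refine Real.exp_le_exp.2 ?_
        rw [hq']
        nlinarith
    _ = y ^ q := (Real.rpow_def_of_pos hy0 q).symm

/-- The contraction factor of the good-`λ` iteration. -/
noncomputable def contr (p : ℝ) : ℝ := 11 / 16 * (3 / 2 * Real.exp 1) ^ (-p)

lemma contr_pos (p : ℝ) : 0 < contr p := by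
  have := Real.exp_pos 1
  unfold contr; positivity

lemma contr_le {p : ℝ} (hp : 0 ≤ p) : contr p ≤ 11 / 16 * (1 / 4) ^ p := by
  unfold contr
  have h4 : (4 : ℝ) ≤ 3 / 2 * Real.exp 1 := by linarith [exp_one_ge]
  rw [Real.rpow_neg (by positivity), one_div, Real.inv_rpow (by norm_num)]
  gcongr

lemma quarter_rpow_le {p : ℝ} (hp : 1 ≤ p) : (1 / 4 : ℝ) ^ p ≤ 1 / 4 :=
  (Real.rpow_le_rpow_of_exponent_ge (by norm_num) (by norm_num) hp).trans_eq (Real.rpow_one _)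

lemma contr_le_const {p : ℝ} (hp : 1 ≤ p) : contr p ≤ 11 / 64 := by
  have := contr_le (p := p) (by linarith)
  linarith [quarter_rpow_le hp]

lemma contr_pow_le {p q : ℝ} (hp : 1 ≤ p) {k : ℕ} (hk : 1 ≤ k) (hqk : q ≤ p * k) :
    contr p ^ k ≤ 11 / 16 * (1 / 4) ^ q := by
  have h1 := contr_le (p := p) (by linarith)
  calc contr p ^ k ≤ (11 / 16 * (1 / 4) ^ p) ^ k := pow_le_pow_left₀ (contr_pos p).le h1 k
    _ = (11 / 16) ^ k * (1 / 4) ^ (p * k) := by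
        rw [mul_pow, Real.rpow_mul (by norm_num), Real.rpow_natCast]
    _ ≤ (11 / 16) ^ 1 * (1 / 4) ^ q := by
        have hA : (11 / 16 : ℝ) ^ k ≤ (11 / 16) ^ 1 :=
          pow_le_pow_of_le_one (by norm_num) (by norm_num) hk
        have hB : (1 / 4 : ℝ) ^ (p * k) ≤ (1 / 4) ^ q :=
          Real.rpow_le_rpow_of_exponent_ge (by norm_num) (by norm_num) hqk
        exact mul_le_mul hA hB (by positivity) (by positivity)
    _ = _ := by rw [pow_one]

lemma two_rpow_mul_quarter_rpow (q : ℝ) : (2 : ℝ) ^ q * (1 / 4) ^ q = (1 / 2) ^ q := by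
  rw [← Real.mul_rpow (by norm_num) (by norm_num)]; norm_num

/-- The lower-order factor of the constant. -/
lemma factor_le {p q : ℝ} (hp : 1 ≤ p) (hq : 0 < q) :
    2 ^ q * contr p ^ ⌈q / p⌉₊ < 1 ∧
    (1 + contr p ^ ⌈q / p⌉₊) * (1 + 2 * (5 / 3) ^ p) * (⌈q / p⌉₊ : ℝ) ^ q /
        (1 - 2 ^ q * contr p ^ ⌈q / p⌉₊) ≤
      2 ^ (p + 1) * (2 ^ q + 1) * (8 / 3 * (q / p)) ^ q := by
  have hp0 : 0 < p := by linarith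
  have hk : 1 ≤ ⌈q / p⌉₊ := Nat.one_le_ceil_iff.2 (by positivity)
  have h2q : (1 : ℝ) ≤ 2 ^ q := Real.one_le_rpow (by norm_num) hq.le
  have h2p1 : (2 : ℝ) ^ (p + 1) = 2 * 2 ^ p := by
    rw [Real.rpow_add (by norm_num), Real.rpow_one]; ring
  have h2p : (0 : ℝ) < 2 ^ p := by positivity
  have hA := one_add_two_mul_rpow_le hp
  -- the bound once the ratio and the power are controlled
  have hmain : ∀ ρ : ℝ, 0 ≤ ρ → ρ ≤ 11 / 64 → 2 ^ q * ρ ≤ 11 / 32 → ∀ T : ℝ, 0 ≤ T →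
      T ≤ (8 / 3 * (q / p)) ^ q → 2 ^ q * ρ < 1 ∧
      (1 + ρ) * (1 + 2 * (5 / 3) ^ p) * T / (1 - 2 ^ q * ρ) ≤
        2 ^ (p + 1) * (2 ^ q + 1) * (8 / 3 * (q / p)) ^ q := by
    intro ρ h0 h1 h2 T hT0 hT
    refine ⟨by linarith, ?_⟩
    rw [div_le_iff₀ (by linarith), h2p1]
    calc (1 + ρ) * (1 + 2 * (5 / 3) ^ p) * T ≤ (75 / 64) * (13 / 6 * 2 ^ p) * T := by
          gcongr; linarith
      _ ≤ 2 * 2 ^ p * 2 * T * (21 / 32) := by nlinarith [mul_nonneg h2p.le hT0]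
      _ ≤ 2 * 2 ^ p * (2 ^ q + 1) * (8 / 3 * (q / p)) ^ q * (1 - 2 ^ q * ρ) := by
          gcongr <;> linarith
  rcases le_or_gt p q with hpq | hpq
  · have hkp : q ≤ p * ⌈q / p⌉₊ := by
      have := Nat.le_ceil (q / p)
      rw [div_le_iff₀ hp0] at this
      linarith
    have hρ := contr_pow_le hp hk hkp
    have hq1 : 1 ≤ q := hp.trans hpq
    refine hmain _ (pow_nonneg (contr_pos p).le _) ?_ ?_ _ (by positivity) ?_
    · linarith [quarter_rpow_le hq1]
    · have h3 : (1 / 2 : ℝ) ^ q ≤ 1 / 2 :=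
        (Real.rpow_le_rpow_of_exponent_ge (by norm_num) (by norm_num) hq1).trans_eq
          (Real.rpow_one _)
      have h4 := two_rpow_mul_quarter_rpow q
      nlinarith
    · refine Real.rpow_le_rpow (by positivity) ?_ hq.le
      have h1 : 1 ≤ q / p := (one_le_div hp0).2 hpq
      have := Nat.ceil_lt_add_one (a := q / p) (by positivity)
      linarith
  · have hk1 : ⌈q / p⌉₊ = 1 := by
      refine le_antisymm (Nat.ceil_le.2 ?_) hk
      rw [Nat.cast_one, div_le_one hp0]; exact hpq.le
    rw [hk1, pow_one, Nat.cast_one, Real.one_rpow]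
    have hc := contr_le hp0.le
    rcases le_or_gt (3 / 8 * p) q with hq38 | hq38
    · refine hmain _ (contr_pos p).le (contr_le_const hp) ?_ 1 (by norm_num) ?_
      · have h1 : (2 : ℝ) ^ q ≤ 2 ^ p := Real.rpow_le_rpow_of_exponent_le (by norm_num) hpq.le
        have h3 : (1 / 2 : ℝ) ^ p ≤ 1 / 2 :=
          (Real.rpow_le_rpow_of_exponent_ge (by norm_num) (by norm_num) hp).trans_eq
            (Real.rpow_one _)
        have h4 := two_rpow_mul_quarter_rpow p
        calc (2 : ℝ) ^ q * contr p ≤ 2 ^ p * (11 / 16 * (1 / 4) ^ p) :=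
              mul_le_mul h1 hc (contr_pos p).le h2p.le
          _ = 11 / 16 * (1 / 2) ^ p := by rw [← h4]; ring
          _ ≤ _ := by linarith
      · refine Real.one_le_rpow ?_ hq.le
        rw [mul_div_assoc', le_div_iff₀ hp0]
        linarith
    · have hsmall : (2 : ℝ) ^ q * contr p ≤ 55 / 224 := by
        have hs : Real.sqrt 2 ≤ 10 / 7 := by
          rw [Real.sqrt_le_left (by norm_num)]; norm_num
        have h1 : (2 : ℝ) ^ q ≤ Real.sqrt 2 ^ p := by
          rw [Real.sqrt_eq_rpow, ← Real.rpow_mul (by norm_num)]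
          exact Real.rpow_le_rpow_of_exponent_le (by norm_num) (by linarith)
        have h2 : Real.sqrt 2 ^ p ≤ (10 / 7) ^ p :=
          Real.rpow_le_rpow (Real.sqrt_nonneg _) hs hp0.le
        have h3 : (10 / 7 : ℝ) ^ p * (1 / 4) ^ p ≤ 5 / 14 := by
          rw [← Real.mul_rpow (by norm_num) (by norm_num)]
          refine (Real.rpow_le_rpow_of_exponent_ge (by norm_num) (by norm_num) hp).trans_eq ?_
          norm_num
        calc (2 : ℝ) ^ q * contr p ≤ (10 / 7) ^ p * (11 / 16 * (1 / 4) ^ p) :=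
              mul_le_mul (h1.trans h2) hc (contr_pos p).le (by positivity)
          _ = 11 / 16 * ((10 / 7) ^ p * (1 / 4) ^ p) := by ring
          _ ≤ 55 / 224 := by linarith
      refine ⟨by linarith, ?_⟩
      rw [div_le_iff₀ (by linarith), h2p1, mul_one]
      have h1 := contr_le_const hp
      have h2 := rpow_ge_of_small hp0 hq
      have h3 := one_add_two_mul_rpow_le' hp
      have h4 : (2 : ℝ) ^ p * (55 / 64) ^ p = (5 / 3) ^ p * (33 / 32) ^ p := by
        rw [← Real.mul_rpow (by norm_num) (by norm_num), ← Real.mul_rpow (by norm_num)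
          (by norm_num)]
        norm_num
      have h5 : (33 / 32 : ℝ) ≤ (33 / 32) ^ p :=
        (Real.rpow_one _).symm.trans_le (Real.rpow_le_rpow_of_exponent_le (by norm_num) hp)
      have h53 : (0 : ℝ) < (5 / 3) ^ p := by positivity
      calc (1 + contr p) * (1 + 2 * (5 / 3) ^ p) ≤ 75 / 64 * (13 / 5 * (5 / 3) ^ p) := by
            have := contr_pos p
            gcongr; linarith
        _ ≤ 2 * ((5 / 3) ^ p * (33 / 32)) * 2 * (169 / 224) := by nlinarith
        _ ≤ 2 * ((5 / 3) ^ p * (33 / 32) ^ p) * 2 * (169 / 224) := by gcongr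
        _ = 2 * 2 ^ p * 2 * (55 / 64) ^ p * (169 / 224) := by rw [← h4]; ring
        _ ≤ 2 * 2 ^ p * (2 ^ q + 1) * (8 / 3 * (q / p)) ^ q * (1 - 2 ^ q * contr p) := by
            gcongr <;> linarith

/-- The constant produced by the good-`λ` argument is at most the stated one. -/
lemma constant_le_maximalConst {p q D : ℝ} (hp : 1 ≤ p) (hq : 0 < q) (hD : 0 ≤ D) :
    2 ^ q * ((1 + contr p ^ ⌈q / p⌉₊) * (4 * (1 + 2 * (5 / 3) ^ p))) *
        (⌈q / p⌉₊ * (1 + 3 / 2 * (Real.exp 1 * 2 ^ (2 + 1 / p) * D))) ^ q /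
        (1 - 2 ^ q * contr p ^ ⌈q / p⌉₊) ≤ maximalConst p q D := by
  have hp0 : 0 < p := by linarith
  obtain ⟨hlt, hfac⟩ := factor_le hp hq
  set ρ := contr p ^ ⌈q / p⌉₊ with hρ
  set h := Real.exp 1 * 2 ^ (2 + 1 / p) * D with hh
  have hh0 : 0 ≤ h := by have := Real.exp_pos 1; positivity
  have hρ0 : 0 ≤ ρ := pow_nonneg (contr_pos p).le _
  have hk0 : (0 : ℝ) ≤ ⌈q / p⌉₊ := Nat.cast_nonneg _
  have e1 : (⌈q / p⌉₊ * (1 + 3 / 2 * h) : ℝ) ^ q ≤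
      (⌈q / p⌉₊ : ℝ) ^ q * ((3 / 2) ^ q * (h + 1) ^ q) := by
    rw [← Real.mul_rpow (by norm_num) (by positivity), ← Real.mul_rpow hk0 (by positivity)]
    refine Real.rpow_le_rpow (by positivity) ?_ hq.le
    gcongr
    linarith
  have e2 : (2 : ℝ) ^ (2 * q + 2) = 4 * (2 ^ q * 2 ^ q) := by
    rw [Real.rpow_add (by norm_num), two_mul, Real.rpow_add (by norm_num)]
    norm_num
    ring
  have e3 : (2 : ℝ) ^ (p + q + 1) = 2 ^ (p + 1) * 2 ^ q := by
    rw [← Real.rpow_add (by norm_num)]; ring_nf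
  have e4 : (3 / 2 : ℝ) ^ q * (8 / 3 * (q / p)) ^ q = 2 ^ q * 2 ^ q * (q / p) ^ q := by
    rw [← Real.mul_rpow (by norm_num) (by positivity), ← Real.mul_rpow (by norm_num) (by norm_num),
      ← Real.mul_rpow (by norm_num) (by positivity)]
    congr 1; ring
  have hden : 0 < 1 - 2 ^ q * ρ := by linarith
  have h2q : (0 : ℝ) < 2 ^ q := by positivity
  calc 2 ^ q * ((1 + ρ) * (4 * (1 + 2 * (5 / 3) ^ p))) * (⌈q / p⌉₊ * (1 + 3 / 2 * h)) ^ q /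
        (1 - 2 ^ q * ρ)
      ≤ 2 ^ q * ((1 + ρ) * (4 * (1 + 2 * (5 / 3) ^ p))) *
        ((⌈q / p⌉₊ : ℝ) ^ q * ((3 / 2) ^ q * (h + 1) ^ q)) / (1 - 2 ^ q * ρ) := by
        gcongr
    _ = 4 * 2 ^ q * (3 / 2) ^ q * (h + 1) ^ q *
        ((1 + ρ) * (1 + 2 * (5 / 3) ^ p) * (⌈q / p⌉₊ : ℝ) ^ q / (1 - 2 ^ q * ρ)) := by ring
    _ ≤ 4 * 2 ^ q * (3 / 2) ^ q * (h + 1) ^ q *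
        (2 ^ (p + 1) * (2 ^ q + 1) * (8 / 3 * (q / p)) ^ q) := by gcongr
    _ = 4 * 2 ^ q * (h + 1) ^ q * 2 ^ (p + 1) * (2 ^ q + 1) *
        ((3 / 2) ^ q * (8 / 3 * (q / p)) ^ q) := by ring
    _ = 2 ^ (2 * q + 2) * (2 ^ (p + q + 1) * (2 ^ q + 1) * (h + 1) ^ q * (q / p) ^ q) := by
        rw [e4, e2, e3]; ring
    _ ≤ maximalConst p q D := by
        unfold maximalConst
        gcongr
        linarith

end Constants

section Subspace

variable {Ω : Type u} {X : Type v} [mΩ : MeasurableSpace Ω] [NormedAddCommGroup X]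
  [NormedSpace ℝ X] [MeasurableSpace X] [BorelSpace X] {μ : Measure Ω} {𝓕 : Filtration ℕ mΩ}
  {Y : Submodule ℝ X}

omit mΩ [MeasurableSpace X] [BorelSpace X] in
lemma preimage_diffSeq_coe (f : ℕ → Ω → Y) (n : ℕ) (B : Set X) :
    diffSeq (fun n ω => (f n ω : X)) n ⁻¹' B = diffSeq f n ⁻¹' ((↑) ⁻¹' B) := by
  ext ω; simp [diffSeq]

omit [BorelSpace X] in
lemma IsDecoupledSum.coe {f g : ℕ → Ω → Y} (hg : IsDecoupledSum μ 𝓕 f g) :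
    IsDecoupledSum μ 𝓕 (fun n ω => (f n ω : X)) (fun n ω => (g n ω : X)) := by
  have hB : ∀ B : Set X, MeasurableSet B → MeasurableSet ((↑) ⁻¹' B : Set Y) := fun B hB =>
    measurable_subtype_coe hB
  refine ⟨by ext ω; simp [hg.1], fun n hn => ?_, fun n hn B hBm => ?_, fun n hn B hBm => ?_⟩
  · exact continuous_subtype_val.comp_stronglyMeasurable (hg.2.stronglyMeasurable n hn)
  · simp only [preimage_diffSeq_coe]
    exact hg.2.tangent n hn _ (hB B hBm)
  · simp only [preimage_diffSeq_coe]
    exact hg.2.condIndep n hn _ fun k => hB _ (hBm k)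

lemma IsDecoupledSum.of_coe [SecondCountableTopology Y] {f g : ℕ → Ω → Y}
    (hg : IsDecoupledSum μ 𝓕 (fun n ω => (f n ω : X)) (fun n ω => (g n ω : X))) :
    IsDecoupledSum μ 𝓕 f g := by
  refine ⟨?_, fun n hn => ?_, fun n hn B hB => ?_, fun n hn B hB => ?_⟩
  · ext ω
    exact congrFun hg.1 ω
  · have h : Measurable fun ω => ((diffSeq g n ω : Y) : X) := by
      have := (hg.2.stronglyMeasurable n hn).measurable
      unfold diffSeq at this ⊢
      simpa only [Submodule.coe_sub] using this
    have h2 : Measurable (diffSeq g n) := h.subtype_mk (h := fun ω => (diffSeq g n ω).2)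
    exact h2.stronglyMeasurable
  · obtain ⟨B', hB', rfl⟩ := hB
    simpa only [preimage_diffSeq_coe] using hg.2.tangent n hn B' hB'
  · choose B' hB' hBB' using hB
    obtain rfl : (fun k => ((↑) ⁻¹' B' k : Set Y)) = B := funext hBB'
    simpa only [preimage_diffSeq_coe] using hg.2.condIndep n hn B' hB'

omit [BorelSpace X] in
lemma DecouplingWith.submodule {p : ℝ} {D : ℝ≥0} (hX : DecouplingWith.{u, v} X p D)
    (Y : Submodule ℝ X) : DecouplingWith.{u, v} Y p D := by
  intro Ω mΩ μ _ _ 𝓕 f g h0 hf0 hf hmem hg n hn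
  have h := hX Ω μ 𝓕 (fun n ω => (f n ω : X)) (fun n ω => (g n ω : X)) h0
    (by ext ω; simp [hf0]) (fun n => continuous_subtype_val.comp_stronglyMeasurable (hf n))
    (fun n => ?_) hg.coe n hn
  · exact h
  · exact (hmem n).of_le
      (continuous_subtype_val.comp_aestronglyMeasurable (hmem n).aestronglyMeasurable)
      (ae_of_all _ fun ω => le_rfl)

end Subspace

section General

variable {X : Type v} [NormedAddCommGroup X] [NormedSpace ℝ X] [CompleteSpace X]
  [MeasurableSpace X] [BorelSpace X] {p q : ℝ} {D : ℝ≥0}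

/-- `K` is a constant in the maximal inequality for conditionally symmetric sequences. -/
def MaximalWith (X : Type v) [NormedAddCommGroup X] [MeasurableSpace X] (q : ℝ) (K : ℝ≥0∞) :
    Prop :=
  ∀ Φ : ℝ≥0 → ℝ≥0, GrowthClass q Φ →
    ∀ (Ω : Type u) [mΩ : MeasurableSpace Ω] (μ : Measure Ω) [IsProbabilityMeasure μ]
      [μ.IsComplete] (𝓕 : Filtration ℕ mΩ) (f g : ℕ → Ω → X),
      𝓕 0 = ⊥ → f 0 = 0 → StronglyAdapted 𝓕 f →
      (∀ n, 1 ≤ n → CondSymmetric μ (𝓕 (n - 1)) (diffSeq f n)) →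
      IsDecoupledSum μ 𝓕 f g → ∀ n, 1 ≤ n →
        ∫⁻ ω, (Φ (maxFun f n ω) : ℝ≥0∞) ∂μ ≤ K * ∫⁻ ω, (Φ ‖g n ω‖₊ : ℝ≥0∞) ∂μ

lemma maximalWith_of_decouplingWith (hX : DecouplingWith.{u, v} X p D) (hp : 0 < p)
    {c ε : ℝ≥0∞} (hc : MidpointConst p c) (hε : ε ≠ 0) (hε' : ε ≠ ⊤) {H : ℝ≥0} (hH : 0 < H)
    {r : ℝ≥0∞} (hr : (D : ℝ≥0∞) ^ p * (c * hjConst p ε) ≤ r * (H : ℝ≥0∞) ^ p) {k : ℕ}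
    (hk : 1 ≤ k) (hq : 0 < q) (hrk : 2 ^ q * r ^ k < 1) :
    MaximalWith.{u, v} X q (2 ^ q * ((1 + r ^ k) * (4 * (1 + ε⁻¹))) *
      ((k * (1 + H) : ℝ≥0) : ℝ≥0∞) ^ q / (1 - 2 ^ q * r ^ k)) := by
  intro Φ hΦ Ω mΩ μ _ _ 𝓕 f g h0 hf0 hf hsymm hg n hn
  have hgs : ∀ n, StronglyMeasurable (g n) := fun n => by
    have : g n = fun ω => ∑ i ∈ Finset.range n, diffSeq g (i + 1) ω := by
      ext ω; exact eq_sum_diffSeq hg.1 n ω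
    rw [this]
    exact Finset.stronglyMeasurable_fun_sum _ fun i _ => hg.2.stronglyMeasurable (i + 1) (by omega)
  have hsep : TopologicalSpace.IsSeparable (⋃ n, (Set.range (f n) ∪ Set.range (g n))) :=
    .iUnion fun n => .union ((hf n).mono (𝓕.le n)).isSeparable_range (hgs n).isSeparable_range
  set Y : Submodule ℝ X :=
    (Submodule.span ℝ (⋃ n, (Set.range (f n) ∪ Set.range (g n)))).topologicalClosure with hY
  have hsub : (⋃ n, (Set.range (f n) ∪ Set.range (g n))) ⊆ (Y : Set X) :=
    Submodule.subset_span.trans (Submodule.le_topologicalClosure _)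
  have hfY : ∀ n ω, f n ω ∈ Y := fun n ω =>
    hsub (Set.mem_iUnion.2 ⟨n, Or.inl ⟨ω, rfl⟩⟩)
  have hgY : ∀ n ω, g n ω ∈ Y := fun n ω =>
    hsub (Set.mem_iUnion.2 ⟨n, Or.inr ⟨ω, rfl⟩⟩)
  have hYsep : TopologicalSpace.IsSeparable (Y : Set X) := by
    rw [hY, Submodule.topologicalClosure_coe]
    exact hsep.span.closure
  have : TopologicalSpace.SeparableSpace Y := hYsep.separableSpace
  have : SecondCountableTopology Y := UniformSpace.secondCountable_of_separable Y
  have : CompleteSpace Y := Submodule.topologicalClosure.completeSpace _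
  have h := lintegral_maxFun_le_of_separable (f := fun n ω => (⟨f n ω, hfY n ω⟩ : Y))
    (g := fun n ω => (⟨g n ω, hgY n ω⟩ : Y)) (μ := μ) (𝓕 := 𝓕) (hX.submodule Y) hp hc h0
    (by ext ω; simp [hf0]) (fun n => ((hf n).measurable.subtype_mk).stronglyMeasurable)
    (fun n hn B hB => ?_) (IsDecoupledSum.of_coe hg) hε hε' hH hr hk hq hrk hΦ hn
  · exact h
  · obtain ⟨B', hB', rfl⟩ := hB
    exact hsymm n hn B' hB'

omit [NormedSpace ℝ X] [CompleteSpace X] [BorelSpace X] in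
lemma MaximalWith.mono {K K' : ℝ≥0∞} (h : MaximalWith.{u, v} X q K) (hK : K ≤ K') :
    MaximalWith.{u, v} X q K' := by
  intro Φ hΦ Ω mΩ μ _ _ 𝓕 f g h0 hf0 hf hsymm hg n hn
  exact (h Φ hΦ Ω μ 𝓕 f g h0 hf0 hf hsymm hg n hn).trans (mul_le_mul_left hK _)

lemma exists_maximalWith (hX : DecouplingWith.{u, v} X p D) (hp : 0 < p) (hp1 : p ≤ 1)
    (hq : 0 < q) : ∃ C : ℝ≥0, MaximalWith.{u, v} X q C := by
  have hTtop : (D : ℝ≥0∞) ^ p * (2 * hjConst p 4⁻¹) ≠ ⊤ :=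
    ENNReal.mul_ne_top (ENNReal.rpow_ne_top_of_nonneg hp.le ENNReal.coe_ne_top)
      (ENNReal.mul_ne_top (by norm_num) (hjConst_ne_top hp1))
  obtain ⟨T, hT⟩ : ∃ T : ℝ≥0, (T : ℝ≥0∞) = (D : ℝ≥0∞) ^ p * (2 * hjConst p 4⁻¹) :=
    ⟨_, ENNReal.coe_toNNReal hTtop⟩
  set ρ : ℝ≥0 := (2 ^ q)⁻¹ / 2 with hρ
  have h2q : (2 : ℝ≥0) ^ q ≠ 0 := (NNReal.rpow_pos (by norm_num)).ne'
  have hρ0 : 0 < ρ := by positivity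
  set H : ℝ≥0 := (T / ρ) ^ (1 / p) + 1 with hH
  have hr : (D : ℝ≥0∞) ^ p * (2 * hjConst p 4⁻¹) ≤ (ρ : ℝ≥0∞) * (H : ℝ≥0∞) ^ p := by
    rw [← hT, ← ENNReal.coe_rpow_of_nonneg _ hp.le, ← ENNReal.coe_mul, ENNReal.coe_le_coe]
    calc T = ρ * ((T / ρ) ^ (1 / p)) ^ p := by
          rw [← NNReal.rpow_mul, one_div_mul_cancel hp.ne', NNReal.rpow_one,
            mul_div_cancel₀ _ hρ0.ne']
      _ ≤ ρ * H ^ p := by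
          gcongr
          exact le_self_add
  have h2 : (2 : ℝ≥0∞) ^ q * (ρ : ℝ≥0∞) ^ 1 = ((1 / 2 : ℝ≥0) : ℝ≥0∞) := by
    rw [pow_one, ← ENNReal.coe_ofNat, ← ENNReal.coe_rpow_of_nonneg _ hq.le, ← ENNReal.coe_mul]
    congr 1
    rw [hρ, mul_div_assoc', mul_inv_cancel₀ h2q]
  have hhalf : ((1 / 2 : ℝ≥0) : ℝ≥0∞) < 1 := by
    rw [← ENNReal.coe_one, ENNReal.coe_lt_coe]
    exact NNReal.half_lt_self one_ne_zero
  have hlt : (2 : ℝ≥0∞) ^ q * (ρ : ℝ≥0∞) ^ 1 < 1 := by rw [h2]; exact hhalf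
  have hmax := maximalWith_of_decouplingWith hX hp (midpointConst_two hp.le) (ε := 4⁻¹)
    (by simp) (by simp) (H := H) (by positivity) hr le_rfl hq hlt
  rw [h2] at hmax
  refine ⟨ENNReal.toNNReal _, hmax.mono (ENNReal.coe_toNNReal ?_).ge⟩
  refine ENNReal.div_ne_top (ENNReal.mul_ne_top (ENNReal.mul_ne_top ?_ (ENNReal.mul_ne_top ?_ ?_))
    ?_) (tsub_pos_of_lt hhalf).ne'
  · exact ENNReal.rpow_ne_top_of_nonneg hq.le (by norm_num)
  · simp
  · simp [ENNReal.mul_eq_top]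
  · exact ENNReal.rpow_ne_top_of_nonneg hq.le ENNReal.coe_ne_top

lemma maximalWith_maximalConst (hX : DecouplingWith.{u, v} X p D) (hD : 0 < D) (hp : 1 ≤ p)
    (hq : 0 < q) : MaximalWith.{u, v} X q (ENNReal.ofReal (maximalConst p q D)) := by
  have hp0 : 0 < p := by linarith
  have he := Real.exp_pos 1
  set h : ℝ := Real.exp 1 * 2 ^ (2 + 1 / p) * D with hh
  have hD' : (0 : ℝ) < D := hD
  have hh0 : 0 < h := by positivity
  set H : ℝ≥0 := (3 / 2 * h).toNNReal with hH
  have hHr : (H : ℝ) = 3 / 2 * h := Real.coe_toNNReal _ (by positivity)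
  have hH0 : 0 < H := by rw [hH, Real.toNNReal_pos]; positivity
  have hr : (D : ℝ≥0∞) ^ p * (1 * hjConst p (ENNReal.ofReal ((3 / 5) ^ p / 2))) ≤
      ENNReal.ofReal (contr p) * (H : ℝ≥0∞) ^ p := by
    rw [one_mul]
    refine (mul_le_mul_right (hjConst_le hp) _).trans_eq ?_
    rw [← ENNReal.ofReal_coe_nnreal (p := D), ← ENNReal.ofReal_coe_nnreal (p := H), hHr,
      ENNReal.ofReal_rpow_of_nonneg D.coe_nonneg hp0.le,
      ENNReal.ofReal_rpow_of_nonneg (by positivity) hp0.le,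
      ← ENNReal.ofReal_mul (by positivity), ← ENNReal.ofReal_mul (contr_pos p).le]
    congr 1
    have e1 : (3 / 2 * h) ^ p = (3 / 2 * Real.exp 1) ^ p * (2 * 4 ^ p) * (D : ℝ) ^ p := by
      have : 3 / 2 * h = 3 / 2 * Real.exp 1 * 2 ^ (2 + 1 / p) * D := by rw [hh]; ring
      rw [this, Real.mul_rpow (by positivity) D.coe_nonneg,
        Real.mul_rpow (by positivity) (by positivity), ← Real.rpow_mul (by norm_num), add_mul,
        one_div_mul_cancel hp0.ne', Real.rpow_add (by norm_num), Real.rpow_one,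
        Real.rpow_mul (by norm_num)]
      have h4 : (2 : ℝ) ^ (2 : ℝ) = 4 := by norm_num
      rw [h4]
      ring
    rw [e1, contr, Real.rpow_neg (by positivity)]
    have : (3 / 2 * Real.exp 1) ^ p ≠ 0 := by positivity
    field_simp
    norm_num
  obtain ⟨hlt, -⟩ := factor_le hp hq
  have hk : 1 ≤ ⌈q / p⌉₊ := Nat.one_le_ceil_iff.2 (by positivity)
  have h2q : (2 : ℝ≥0∞) ^ q = ENNReal.ofReal (2 ^ q) := by
    rw [← ENNReal.ofReal_rpow_of_nonneg (by norm_num) hq.le]; simp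
  have hρ : (2 : ℝ≥0∞) ^ q * ENNReal.ofReal (contr p) ^ ⌈q / p⌉₊ =
      ENNReal.ofReal (2 ^ q * contr p ^ ⌈q / p⌉₊) := by
    rw [h2q, ← ENNReal.ofReal_pow (contr_pos p).le, ← ENNReal.ofReal_mul (by positivity)]
  have hrk : (2 : ℝ≥0∞) ^ q * ENNReal.ofReal (contr p) ^ ⌈q / p⌉₊ < 1 := by
    rw [hρ, ENNReal.ofReal_lt_one]
    exact hlt
  have hε0 : (0 : ℝ) < (3 / 5) ^ p / 2 := by positivity
  have hmax := maximalWith_of_decouplingWith hX hp0 (midpointConst_one hp)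
    (by simpa using hε0) ENNReal.ofReal_ne_top hH0 hr hk hq hrk
  refine hmax.mono ?_
  refine le_trans (le_of_eq ?_) (ENNReal.ofReal_le_ofReal
    (constant_le_maximalConst hp hq D.coe_nonneg))
  have hc0 := pow_nonneg (contr_pos p).le ⌈q / p⌉₊
  have hεinv : (ENNReal.ofReal ((3 / 5) ^ p / 2))⁻¹ = ENNReal.ofReal (2 * (5 / 3) ^ p) := by
    rw [← ENNReal.ofReal_inv_of_pos hε0]
    congr 1
    rw [inv_div, div_eq_mul_inv, ← Real.inv_rpow (by norm_num)]
    norm_num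
  have hL : ((⌈q / p⌉₊ * (1 + H) : ℝ≥0) : ℝ≥0∞) = ENNReal.ofReal (⌈q / p⌉₊ * (1 + 3 / 2 * h)) := by
    rw [← ENNReal.ofReal_coe_nnreal]
    congr 1
    push_cast
    rw [hHr]
  have h1ε : (1 : ℝ≥0∞) + ENNReal.ofReal (2 * (5 / 3) ^ p) =
      ENNReal.ofReal (1 + 2 * (5 / 3) ^ p) := by
    rw [ENNReal.ofReal_add zero_le_one (by positivity), ENNReal.ofReal_one]
  have h1r : (1 : ℝ≥0∞) + ENNReal.ofReal (contr p) ^ ⌈q / p⌉₊ =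
      ENNReal.ofReal (1 + contr p ^ ⌈q / p⌉₊) := by
    rw [ENNReal.ofReal_add zero_le_one hc0, ENNReal.ofReal_one,
      ENNReal.ofReal_pow (contr_pos p).le]
  have hden : (1 : ℝ≥0∞) - ENNReal.ofReal (2 ^ q * contr p ^ ⌈q / p⌉₊) =
      ENNReal.ofReal (1 - 2 ^ q * contr p ^ ⌈q / p⌉₊) := by
    rw [ENNReal.ofReal_sub _ (by positivity), ENNReal.ofReal_one]
  rw [hρ, hden, h1r, hεinv, h1ε, hL, h2q, ENNReal.ofReal_rpow_of_nonneg (by positivity) hq.le,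
    ← ENNReal.ofReal_ofNat 4, ← ENNReal.ofReal_mul (by norm_num),
    ← ENNReal.ofReal_mul (by positivity), ← ENNReal.ofReal_mul (by positivity),
    ← ENNReal.ofReal_mul (by positivity), ← ENNReal.ofReal_div_of_pos (by linarith)]

omit [NormedSpace ℝ X] [CompleteSpace X] [BorelSpace X] in
lemma DecouplingWith.mono {D' : ℝ≥0} (hX : DecouplingWith.{u, v} X p D) (h : D ≤ D') :
    DecouplingWith.{u, v} X p D' := by
  intro Ω mΩ μ _ _ 𝓕 f g h0 hf0 hf hmem hg n hn
  exact (hX Ω μ 𝓕 f g h0 hf0 hf hmem hg n hn).trans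
    (mul_le_mul_left (ENNReal.coe_le_coe.2 h) _)

lemma maximalConst_pos (hp : 0 < p) (hq : 0 < q) {D : ℝ} (hD : 0 ≤ D) :
    0 < maximalConst p q D := by
  have := Real.exp_pos 1
  unfold maximalConst
  positivity

lemma continuous_maximalConst (hq : 0 < q) : Continuous (maximalConst p q) := by
  unfold maximalConst
  have : Continuous fun D : ℝ => (Real.exp 1 * 2 ^ (2 + 1 / p) * D + 1) ^ q :=
    (by fun_prop : Continuous fun D : ℝ => Real.exp 1 * 2 ^ (2 + 1 / p) * D + 1).rpow_const
      fun _ => Or.inr hq.le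
  fun_prop

lemma maximalWith_decouplingConst (hX : DecouplingInequality.{u, v} X p) (hp : 1 ≤ p)
    (hq : 0 < q) :
    MaximalWith.{u, v} X q
      (ENNReal.ofReal (maximalConst p q (decouplingConst.{u, v} X p : ℝ))) := by
  intro Φ hΦ Ω mΩ μ _ _ 𝓕 f g h0 hf0 hf hsymm hg n hn
  set D₀ := decouplingConst.{u, v} X p with hD₀
  have hbound : ∀ m : ℕ, ∫⁻ ω, (Φ (maxFun f n ω) : ℝ≥0∞) ∂μ ≤
      ENNReal.ofReal (maximalConst p q ((D₀ : ℝ) + 1 / ((m : ℝ) + 1))) *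
        ∫⁻ ω, (Φ ‖g n ω‖₊ : ℝ≥0∞) ∂μ := by
    intro m
    have hpos : (0 : ℝ≥0) < 1 / ((m : ℝ≥0) + 1) := by positivity
    obtain ⟨D, hD, hlt⟩ := exists_lt_of_csInf_lt (s := {D : ℝ≥0 | DecouplingWith.{u, v} X p D}) hX
      (lt_add_of_pos_right D₀ hpos)
    have := maximalWith_maximalConst (DecouplingWith.mono hD hlt.le)
      (lt_of_le_of_lt zero_le hlt) hp hq Φ hΦ Ω μ 𝓕 f g h0 hf0 hf hsymm hg n hn
    simpa using this
  have htend : Filter.Tendsto (fun m : ℕ => (D₀ : ℝ) + 1 / ((m : ℝ) + 1)) Filter.atTop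
      (nhds (D₀ : ℝ)) := by
    simpa using (tendsto_const_nhds (x := (D₀ : ℝ))).add
      (tendsto_one_div_add_atTop_nhds_zero_nat (𝕜 := ℝ))
  have hC := (continuous_maximalConst (p := p) hq).continuousAt.tendsto.comp htend
  refine ge_of_tendsto' (ENNReal.Tendsto.mul_const (ENNReal.tendsto_ofReal hC) (Or.inl ?_)) hbound
  have := maximalConst_pos (by linarith : 0 < p) hq D₀.coe_nonneg
  simpa using this

end General

end Decoupling

theorem corollary4p2 (X : Type v) [NormedAddCommGroup X] [NormedSpace ℝ X] [CompleteSpace X]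
    [MeasurableSpace X] [BorelSpace X] (p : ℝ) (hp : 0 < p)
    (hX : Decoupling.DecouplingInequality.{u, v} X p) (q : ℝ) (hq : 0 < q) :
    ∃ C : ℝ≥0,
      (1 ≤ p →
        (C : ℝ) = Decoupling.maximalConst p q (Decoupling.decouplingConst.{u, v} X p : ℝ)) ∧
      ∀ Φ : ℝ≥0 → ℝ≥0, Decoupling.GrowthClass q Φ →
      ∀ (Ω : Type u) [mΩ : MeasurableSpace Ω] (μ : Measure Ω) [IsProbabilityMeasure μ]
        [μ.IsComplete] (𝓕 : Filtration ℕ mΩ) (f g : ℕ → Ω → X),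
        𝓕 0 = ⊥ → f 0 = 0 → StronglyAdapted 𝓕 f →
        (∀ n, 1 ≤ n → Decoupling.CondSymmetric μ (𝓕 (n - 1)) (Decoupling.diffSeq f n)) →
        Decoupling.IsDecoupledSum μ 𝓕 f g →
        ∀ n, 1 ≤ n →
          ∫⁻ ω, (Φ (Decoupling.maxFun f n ω) : ℝ≥0∞) ∂μ ≤
            (C : ℝ≥0∞) * ∫⁻ ω, (Φ ‖g n ω‖₊ : ℝ≥0∞) ∂μ := by
  rcases le_or_gt 1 p with h1 | h1
  · have hpos := Decoupling.maximalConst_pos hp hq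
      (Decoupling.decouplingConst.{u, v} X p).coe_nonneg
    exact ⟨(Decoupling.maximalConst p q (Decoupling.decouplingConst.{u, v} X p : ℝ)).toNNReal,
      fun _ => Real.coe_toNNReal _ hpos.le, Decoupling.maximalWith_decouplingConst hX h1 hq⟩
  · obtain ⟨D, hD⟩ := hX
    obtain ⟨C, hC⟩ := Decoupling.exists_maximalWith hD hp h1.le hq
    exact ⟨C, fun h => absurd h (not_le.2 h1), hC⟩
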